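/- Let $d\ge 1$ and let $\mathbb T^d$ be the torus $(\mathbb R/2\pi\mathbb Z)^d$ with the probability measure $(2\pi)^{-d}dx$; for $f\in L_1(\mathbb T^d)$ put $\hat f(k)=(2\pi)^{-d}\int_{\mathbb T^d}f(x)e^{-ik\cdot x}\,dx$, $k\in\mathbb Z^d$. Let $\omega=(\omega(k))_{k\in\mathbb Z^d}$ be a family of positive numbers with $\omega(k)\to\infty$ as $|k_1|+\dots+|k_d|\to\infty$, and let $\lambda_1\ge\lambda_2\ge\cdots$ be the non-increasing rearrangement of $(1/\omega(k))_{k\in\mathbb Z^d}$. For $0<p\le\infty$ let $F_{\omega,p}$ be the class of all $f\in L_1(\mathbb T^d)$ with $$\|f\|_{F_{\omega,p}}=\Big(\sum_{k\in\mathbb Z^d}|\omega(k)\hat f(k)|^p\Big)^{1/p}<\infty$$ (supremum over $k$ if $p=\infty$), and let $F_p$ be this class for $\omega\equiv1$. For $n\in\mathbb N$ let $$\sigma_n^{p,q}=\sup_{\|f\|_{F_{\omega,p}}\le1}\ \inf\Big\{\Big\|f-\sum_{j=1}^n a_je^{ik_j\cdot x}\Big\|_{F_q}:\ a_1,\dots,a_n\in\mathbb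 C,\ k_1,\dots,k_n\in\mathbb Z^d\Big\}$$ be the best $n$-term approximation width of $\mathrm{id}:F_{\omega,p}\to F_q$ with respect to the trigonometric system. **Theorem.** Let $s>0$, $\beta\ge0$, $C\in\mathbb R$, and suppose that $\lim_{n\to\infty}\lambda_n/(n^{-s}(\ln n)^\beta)=C$. (i) Let $0<p\le q\le\infty$. Then all $\sigma_n^{p,q}$ are finite and $$\lim_{n\to\infty}\frac{\sigma_n^{p,q}}{n^{-s-1/p+1/q}(\ln n)^\beta}=K\,C,\qquad K=\frac{(s+\frac1p-\frac1q)^{s+\frac1p-\frac1q}}{(s+\frac1p)^s}\,\frac{p^{1/p}}{q^{1/q}}\quad\text{if } q<\infty.$$ If $p<q=\infty$, then $K=(sp+1)^{1/p}$, which is the limit of the preceding constant as $q\to\infty$. If $p=q=\infty$, then $K=1$, which is its limit as $p,q\to\infty$. (Here $1/\infty=0$.) (ii) Let $0<q<p<\infty$ and $s>\frac1q-\frac1p$. Then all $\sigma_n^{p,q}$ are finite and $$\lim_{n\to\infty}\frac{\sigma_n^{p,q}}{n^{-s-1/p+1/q}(\ln n)^\beta}=\Big(\frac{s}{s+\frac1p}\Big)^s\Big(\frac{\frac1q}{s+\frac1p-\frac1q}\Big)^{\frac1q-\frac1p}C.$$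 -/

import Mathlib

open Filter Topology MeasureTheory
open scoped ENNReal

noncomputable section

instance factTwoPiPos : Fact (0 < 2 * Real.pi) := ⟨Real.two_pi_pos⟩

/-- The `d`-dimensional torus, each factor being the interval `[0, 2π]` with identified end points. -/
abbrev Torus (d : ℕ) : Type := Fin d → AddCircle (2 * Real.pi)

/-- The normalized (probability) measure `(2π)^{-d} dx` on the torus. -/
def torusMeasure (d : ℕ) : Measure (Torus d) :=
  Measure.pi fun _ => AddCircle.haarAddCircle

instance (d : ℕ) : IsProbabilityMeasure (torusMeasure d) := by
  unfold torusMeasure; infer_instance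

/-- The space `L_1(𝕋^d)`. -/
abbrev TorusL1 (d : ℕ) : Type := Lp ℂ 1 (torusMeasure d)

/-- The trigonometric monomial `x ↦ e^{i k·x} = ∏ e^{i k_j x_j}`. -/
def trigMonomial {d : ℕ} (k : Fin d → ℤ) : C(Torus d, ℂ) where
  toFun x := ∏ i, fourier (k i) (x i)
  continuous_toFun := by fun_prop

/-- The trigonometric system `{e^{i k·x} : k ∈ ℤ^d}`, as a subset of `L_1(𝕋^d)`. -/
def trigSystem (d : ℕ) : Set (TorusL1 d) :=
  Set.range fun k : Fin d → ℤ =>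
    ContinuousMap.toLp (E := ℂ) 1 (torusMeasure d) ℂ (trigMonomial k)

/-- The Fourier coefficient `(2π)^{-d} ∫ f(x) e^{-i k·x} dx`. -/
def torusFourierCoeff {d : ℕ} (f : TorusL1 d) (k : Fin d → ℤ) : ℂ :=
  ∫ x, f x * trigMonomial (-k) x ∂(torusMeasure d)

/-- The `ℓ_p` (quasi-)norm of a family of complex numbers, `0 < p ≤ ∞`, with value `∞` if the
family is not in `ℓ_p`. -/
def ellNorm {ι : Type*} (p : ℝ≥0∞) (a : ι → ℂ) : ℝ≥0∞ :=
  if p = ∞ then ⨆ k, ‖a k‖ₑ else (∑' k, ‖a k‖ₑ ^ p.toReal) ^ (1 / p.toReal)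

/-- The (quasi-)norm `‖f‖_{F_{ω,p}} = (∑ |ω(k) f̂(k)|^p)^{1/p}` of `f ∈ L_1(𝕋^d)`, with value `∞` if
`f` is not in `F_{ω,p}(𝕋^d)`. -/
def weightedNorm {d : ℕ} (ω : (Fin d → ℤ) → ℝ) (p : ℝ≥0∞) (f : TorusL1 d) : ℝ≥0∞ :=
  ellNorm p fun k => (ω k : ℂ) * torusFourierCoeff f k

/-- The class `F_{ω,p}(𝕋^d)`. -/
def weightedClass {d : ℕ} (ω : (Fin d → ℤ) → ℝ) (p : ℝ≥0∞) : Set (TorusL1 d) :=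
  {f | weightedNorm ω p f < ∞}

/-- The error of best `n`-term approximation of `g` by the dictionary `D`, measured in `N`. -/
def bestTermError {E : Type*} [AddCommGroup E] [Module ℂ E] (N : E → ℝ≥0∞) (D : Set E)
    (n : ℕ) (g : E) : ℝ≥0∞ :=
  ⨅ (a : Fin n → ℂ) (y : Fin n → D), N (g - ∑ j, a j • (y j : E))

/-- The best `n`-term approximation width `σ_n(id : F_{ω,p}(𝕋^d) → F_q(𝕋^d), 𝒯^d)`; here
`F_q` is the class with the constant weight `1`. -/
def termWidth {d : ℕ} (ω : (Fin d → ℤ) → ℝ) (p q : ℝ≥0∞) (n : ℕ) : ℝ≥0∞ :=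
  ⨆ f ∈ {f : TorusL1 d | f ∈ weightedClass ω p ∧ weightedNorm ω p f ≤ 1},
    bestTermError (weightedNorm (fun _ => 1) q) (trigSystem d) n f

/-- The non-increasing rearrangement `a*_1 ≥ a*_2 ≥ …` of a nonnegative family `a` tending to `0`
along the cofinite filter: `a*_n` is the least `t ≥ 0` such that fewer than `n` members of the family
(counted with multiplicity) exceed `t`. Only `n ≥ 1` is meaningful. -/
def decreasingRearrangement {ι : Type*} (a : ι → ℝ) (n : ℕ) : ℝ :=
  sInf {t : ℝ | 0 ≤ t ∧ {k | t < a k}.encard < n}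

/-- The constant for `0 < p ≤ q < ∞`. -/
def constLE (s p q : ℝ) : ℝ :=
  (s + 1 / p - 1 / q) ^ (s + 1 / p - 1 / q) / (s + 1 / p) ^ s * (p ^ (1 / p) / q ^ (1 / q))

/-- The constant for `0 < q < p < ∞`. -/
def constGT (s p q : ℝ) : ℝ :=
  (s / (s + 1 / p)) ^ s * ((1 / q) / (s + 1 / p - 1 / q)) ^ (1 / q - 1 / p)

end

/-!
The width depends on `f` only through its Fourier coefficients. The best `n`-term approximation
keeps the `n` largest of them, and trigonometric polynomials realize every finite family of
coefficients, so the width is the supremum of the `ℓ_q` norms of `(b_k)_{k ≥ n}` over nonincreasing sequences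
`b ≥ 0` with `∑ (b_k / l_k) ^ p ≤ 1`, where `l` is the nonincreasing rearrangement of `1 / ω`,
indexed from `0` (`termWidth_le_of_sum_Ico_le`, `ofReal_sum_Ico_le_termWidth`). Write
`W_N = ∑_{k < N} l_k ^ (-p)`.

For `p ≤ q` the supremum equals `sup_{N > n} (N - n) ^ (1/q) W_N ^ (-1/p)`: constant sequences on
`[0, N)` give the lower bound, and Abel summation with the convexity of `x ^ (q/p)` gives the upper
one (`sum_Ico_rpow_le_of_le`). If `l_k ∼ C k ^ (-s) (log k) ^ β`, the theorem of Stolz and Cesàro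
gives `W_N ^ (-1/p) ∼ C (s p + 1) ^ (1/p) N ^ (-s - 1/p) (log N) ^ β`, and with `N = x n` the
constant is the maximum of `(x - 1) ^ (1/q) x ^ (-s - 1/p)`. The only loss of uniformity in `x` is the factor
`(log N / log n) ^ β`, which is at most a small power of `x` (`eventually_forall_mul_le`).
For `q = ∞` only `N = n + 1` matters, and for `p = q = ∞` the width is `l_n` (`termWidth_top_top`).

For `q < p` put `1 / r = 1 / q - 1 / p`. With `A` an upper bound of `(m - n) / W_m`, which is the
problem just solved for `q = p`, the indicator of `k ≥ n` is majorized by the weight `A l_k ^ (-p)`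
for `k < N` and `1` for `k ≥ N`. Hölder's inequality bounds the tail by
`(A ^ (r/q) W_N + ∑_{k ≥ N} l_k ^ r) ^ (1/r)` (`sum_Ico_rpow_le_of_lt`). For `N ∼ t n` with
`t = (s + 1/p) / s` this is asymptotically attained by the sequence proportional to
`l_{max(k, N)} ^ (r/q)` (`le_termWidth_of_lt`).

The upper bounds only need a majorant of `l`, which may be chosen asymptotic to
`D k ^ (-s) (log k) ^ β` for any `D > C`. This covers the case `C = 0` as well.
-/

/-! ### Nonincreasing rearrangements -/

/-- A family of nonnegative numbers that tends to `0` has a largest member outside any finite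
set. -/
lemma exists_max_notMem {ι : Type*} [Infinite ι] {a : ι → ℝ} (h0 : ∀ k, 0 ≤ a k)
    (ha : Tendsto a cofinite (𝓝 0)) (S : Finset ι) :
    ∃ k ∉ S, ∀ j ∉ S, a j ≤ a k := by
  by_cases h : ∃ j ∉ S, 0 < a j
  · obtain ⟨j, hj, hpos⟩ := h
    have hfin : {k | a j ≤ a k}.Finite := by
      have := ha.eventually (gt_mem_nhds hpos)
      rw [Filter.eventually_cofinite] at this
      simpa using this
    obtain ⟨k, hk, hmax⟩ := Set.exists_max_image ({k | a j ≤ a k} \ S) a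
      (hfin.subset Set.sdiff_subset)
      ⟨j, by simpa using hj⟩
    refine ⟨k, by simpa using hk.2, fun i hi => ?_⟩
    by_cases hij : a j ≤ a i
    · exact hmax i ⟨hij, by simpa using hi⟩
    · exact (not_le.1 hij).le.trans hk.1
  · push Not at h
    obtain ⟨k, hk⟩ := Infinite.exists_notMem_finset S
    exact ⟨k, hk, fun j hj => (h j hj).trans (h0 k)⟩

/-- A family of nonnegative numbers that tends to `0` can be listed in nonincreasing order; only
members equal to `0` may be missing from the list. -/
lemma exists_antitone_enumeration {ι : Type*} [Infinite ι] {a : ι → ℝ} (h0 : ∀ k, 0 ≤ a k)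
    (ha : Tendsto a cofinite (𝓝 0)) :
    ∃ e : ℕ → ι, Function.Injective e ∧ Antitone (fun n => a (e n)) ∧
      ∀ k ∉ Set.range e, a k = 0 := by
  classical
  choose pick hpick hmax using exists_max_notMem h0 ha
  let S : ℕ → Finset ι := fun n => Nat.rec ∅ (fun _ T => insert (pick T) T) n
  have hS : ∀ n, S (n + 1) = insert (pick (S n)) (S n) := fun n => rfl
  have hmono : Monotone S := monotone_nat_of_le_succ fun n => by
    rw [hS]; exact Finset.subset_insert _ _
  have hmem : ∀ {i n}, i < n → pick (S i) ∈ S n := fun {i n} h =>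
    hmono h (by rw [hS]; exact Finset.mem_insert_self _ _)
  have hinj : Function.Injective fun n => pick (S n) := by
    intro i j hij
    by_contra hne
    rcases lt_or_gt_of_ne hne with h | h
    · exact hpick (S j) (by simpa [← hij] using hmem h)
    · exact hpick (S i) (by simpa [hij] using hmem h)
  refine ⟨fun n => pick (S n), hinj, antitone_nat_of_succ_le fun n => ?_, fun k hk => ?_⟩
  · exact hmax (S n) _ fun h => hpick (S (n + 1)) (hmono n.le_succ h)
  · have hkS : ∀ n, k ∉ S n := by
      intro n
      induction n with
      | zero => simp [S]
      | succ n ih =>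
        rw [hS, Finset.mem_insert, not_or]
        exact ⟨fun h => hk ⟨n, h.symm⟩, ih⟩
    have hlim : Tendsto (fun n => a (pick (S n))) atTop (𝓝 0) := by
      rw [← Nat.cofinite_eq_atTop]
      exact ha.comp hinj.tendsto_cofinite
    exact le_antisymm (ge_of_tendsto' hlim fun n => hmax (S n) k (hkS n)) (h0 k)

/-- A nonincreasing listing of the family is its nonincreasing rearrangement. -/
lemma decreasingRearrangement_succ {ι : Type*} {a : ι → ℝ} (h0 : ∀ k, 0 ≤ a k) {e : ℕ → ι}
    (he : Function.Injective e) (hanti : Antitone fun n => a (e n))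
    (hrange : ∀ k ∉ Set.range e, a k = 0) (n : ℕ) :
    decreasingRearrangement a (n + 1) = a (e n) := by
  apply IsLeast.csInf_eq
  constructor
  · refine ⟨h0 _, ?_⟩
    have hsub : {k | a (e n) < a k} ⊆ e '' (Finset.range n : Set ℕ) := by
      intro k hk
      have hk' : a (e n) < a k := hk
      by_cases hr : k ∈ Set.range e
      · obtain ⟨m, rfl⟩ := hr
        refine ⟨m, ?_, rfl⟩
        by_contra hm
        exact absurd (hanti (show n ≤ m by simpa using hm)) (not_le.2 hk')
      · exact absurd (h0 (e n)) (not_le.2 (hrange k hr ▸ hk'))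
    calc _ ≤ _ := Set.encard_le_encard hsub
      _ = n := by rw [he.injOn.encard_image, Set.encard_coe_eq_coe_finsetCard, Finset.card_range]
      _ < _ := by exact_mod_cast n.lt_succ_self
  · rintro t ⟨-, ht⟩
    by_contra hlt
    have hsub : e '' (Finset.range (n + 1) : Set ℕ) ⊆ {k | t < a k} := by
      rintro _ ⟨m, hm, rfl⟩
      exact (not_le.1 hlt).trans_le (hanti (by simpa [Nat.lt_succ_iff] using hm))
    have := (Set.encard_le_encard hsub).trans_lt ht
    rw [he.injOn.encard_image, Set.encard_coe_eq_coe_finsetCard, Finset.card_range] at this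
    exact lt_irrefl _ this

/-- Abel summation. -/
lemma sum_mul_nonneg_of_antitone {u x : ℕ → ℝ} (hu : Antitone u) (hu0 : ∀ n, 0 ≤ u n)
    (hx : ∀ n, 0 ≤ ∑ k ∈ Finset.range n, x k) (N : ℕ) :
    0 ≤ ∑ k ∈ Finset.range N, u k * x k := by
  suffices h : ∀ N, u N * ∑ k ∈ Finset.range (N + 1), x k ≤
      ∑ k ∈ Finset.range (N + 1), u k * x k by
    cases N with
    | zero => simp
    | succ N => exact (mul_nonneg (hu0 _) (hx _)).trans (h N)
  intro N
  induction N with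
  | zero => simp
  | succ N ih =>
    rw [Finset.sum_range_succ _ (N + 1), Finset.sum_range_succ (fun k => u k * x k), mul_add]
    have := mul_le_mul_of_nonneg_right (hu N.le_succ) (hx (N + 1))
    linarith

lemma sum_mul_le_sum_mul_of_antitone {u x y : ℕ → ℝ} (hu : Antitone u) (hu0 : ∀ n, 0 ≤ u n)
    (hxy : ∀ n, ∑ k ∈ Finset.range n, x k ≤ ∑ k ∈ Finset.range n, y k) (N : ℕ) :
    ∑ k ∈ Finset.range N, u k * x k ≤ ∑ k ∈ Finset.range N, u k * y k := by
  have := sum_mul_nonneg_of_antitone (x := fun k => y k - x k) hu hu0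
    (fun n => by simpa using hxy n) N
  simpa [mul_sub] using this

lemma sum_range_card_le_of_monotone {v : ℕ → ℝ} (hv : Monotone v) (S : Finset ℕ) :
    ∑ k ∈ Finset.range S.card, v k ≤ ∑ k ∈ S, v k := by
  induction S using Finset.induction_on_max with
  | empty => simp
  | insert a S hS ih =>
    have ha : a ∉ S := fun h => lt_irrefl _ (hS a h)
    have hcard : S.card ≤ a := by
      simpa using Finset.card_le_card (show S ⊆ Finset.range a from
        fun x hx => by simpa using hS x hx)
    rw [Finset.card_insert_of_notMem ha, Finset.sum_range_succ, Finset.sum_insert ha, add_comm]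
    exact add_le_add (hv hcard) ih

lemma sum_le_sum_range_card_of_antitone {v : ℕ → ℝ} (hv : Antitone v) (S : Finset ℕ) :
    ∑ k ∈ S, v k ≤ ∑ k ∈ Finset.range S.card, v k := by
  have := sum_range_card_le_of_monotone (v := fun k => - v k) (fun a b h => neg_le_neg (hv h)) S
  simpa using this

lemma sum_range_le_sum_comp_of_injective {v : ℕ → ℝ} (hv : Monotone v) {σ : ℕ → ℕ}
    (hσ : Function.Injective σ) (N : ℕ) :
    ∑ k ∈ Finset.range N, v k ≤ ∑ k ∈ Finset.range N, v (σ k) := by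
  have := sum_range_card_le_of_monotone hv ((Finset.range N).image σ)
  rwa [Finset.card_image_of_injective _ hσ, Finset.card_range,
    Finset.sum_image hσ.injOn] at this

/-! ### Tails of nonincreasing sequences in weighted balls -/

/-- Increments of the convex function `x ^ θ` over intervals of the same length increase. -/
lemma rpow_add_sub_rpow_le {θ x y h : ℝ} (hθ : 1 ≤ θ) (hy : 0 ≤ y) (hyx : y ≤ x) (hh : 0 ≤ h) :
    (y + h) ^ θ - y ^ θ ≤ (x + h) ^ θ - x ^ θ := by
  rcases (show y ≤ x + h by linarith).eq_or_lt with hD | hD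
  · have h1 : h = 0 := by linarith
    simp [h1]
  have hc := convexOn_rpow hθ
  have hD' : 0 < x + h - y := by linarith
  have hm1 : y ∈ Set.Ici (0 : ℝ) := hy
  have hm2 : x + h ∈ Set.Ici (0 : ℝ) := by simp only [Set.mem_Ici]; linarith
  have hs : 0 ≤ h / (x + h - y) := by positivity
  have hs' : 0 ≤ (x - y) / (x + h - y) := div_nonneg (by linarith) hD'.le
  have e3 : (x - y) / (x + h - y) + h / (x + h - y) = 1 := by
    field_simp; ring
  have h1 := hc.2 hm1 hm2 hs' hs e3
  have h2 := hc.2 hm1 hm2 hs hs' (by rw [add_comm]; exact e3)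
  simp only [smul_eq_mul] at h1 h2
  have e1 : (x - y) / (x + h - y) * y + h / (x + h - y) * (x + h) = y + h := by
    field_simp; ring
  have e2 : h / (x + h - y) * y + (x - y) / (x + h - y) * (x + h) = x := by
    field_simp; ring
  rw [e1] at h1
  rw [e2] at h2
  have e4 : (x - y) / (x + h - y) = 1 - h / (x + h - y) := by linarith
  rw [e4] at h1 h2
  linarith

/-- A weighted form of `ℓ_1 ⊆ ℓ_θ` for nonincreasing sequences. -/
lemma sum_rpow_mul_sub_le {θ : ℝ} (hθ : 1 ≤ θ) {u w : ℕ → ℝ} (hu : Antitone u)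
    (hu0 : ∀ n, 0 ≤ u n) (hw : ∀ n, 0 ≤ w n) (N : ℕ) :
    ∑ k ∈ Finset.range N, u k ^ θ *
      ((∑ i ∈ Finset.range (k + 1), w i) ^ θ - (∑ i ∈ Finset.range k, w i) ^ θ) ≤
      (∑ k ∈ Finset.range N, u k * w k) ^ θ := by
  induction N with
  | zero => simp [Real.zero_rpow (by linarith : θ ≠ 0)]
  | succ N ih =>
    have hW : 0 ≤ ∑ i ∈ Finset.range N, w i := Finset.sum_nonneg fun i _ => hw i
    have hle : u N * ∑ i ∈ Finset.range N, w i ≤ ∑ k ∈ Finset.range N, u k * w k := by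
      rw [Finset.mul_sum]
      exact Finset.sum_le_sum fun i hi =>
        mul_le_mul_of_nonneg_right (hu (Finset.mem_range.1 hi).le) (hw i)
    have h := rpow_add_sub_rpow_le hθ (mul_nonneg (hu0 N) hW) hle (mul_nonneg (hu0 N) (hw N))
    rw [← mul_add, Real.mul_rpow (hu0 N) (add_nonneg hW (hw N)), Real.mul_rpow (hu0 N) hW,
      ← mul_sub] at h
    rw [Finset.sum_range_succ, Finset.sum_range_succ _ N, Finset.sum_range_succ _ N]
    linarith

lemma sum_range_ite_le (n m : ℕ) :
    ∑ k ∈ Finset.range m, (if n ≤ k then (1 : ℝ) else 0) = ((m - n : ℕ) : ℝ) := by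
  rw [Finset.sum_ite, Finset.sum_const_zero, add_zero, Finset.sum_const, nsmul_eq_mul, mul_one,
    show (Finset.range m).filter (fun k => n ≤ k) = Finset.Ico n m by ext k; simp [and_comm]]
  simp

lemma sum_Ico_eq_sum_range_ite (f : ℕ → ℝ) (n m : ℕ) :
    ∑ k ∈ Finset.Ico n m, f k = ∑ k ∈ Finset.range m, f k * (if n ≤ k then (1 : ℝ) else 0) := by
  simp only [mul_ite, mul_one, mul_zero]
  rw [← Finset.sum_filter]
  congr 1
  ext k; simp [and_comm]

/-- The partial sums `∑_{k < N} l_k^{-p}`. -/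
noncomputable def invPowSum (l : ℕ → ℝ) (p : ℝ) (N : ℕ) : ℝ := ∑ k ∈ Finset.range N, l k ^ (-p)

lemma invPowSum_nonneg {l : ℕ → ℝ} (hl : ∀ k, 0 < l k) (p : ℝ) (N : ℕ) : 0 ≤ invPowSum l p N :=
  Finset.sum_nonneg fun k _ => Real.rpow_nonneg (hl k).le _

lemma invPowSum_pos {l : ℕ → ℝ} (hl : ∀ k, 0 < l k) (p : ℝ) {N : ℕ} (hN : 0 < N) :
    0 < invPowSum l p N :=
  Finset.sum_pos (fun k _ => Real.rpow_pos_of_pos (hl k) _) ⟨0, by simpa using hN⟩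

/-- The tail of a nonincreasing sequence in the weighted `ℓ_p` ball, for `p ≤ q < ∞`. -/
theorem sum_Ico_rpow_le_of_le {l b : ℕ → ℝ} (hl : ∀ k, 0 < l k) (hb : Antitone b)
    (hb0 : ∀ k, 0 ≤ b k) {p q R : ℝ} (hp : 0 < p) (hpq : p ≤ q) (hR : 0 ≤ R) {n : ℕ}
    (hball : ∀ M, ∑ k ∈ Finset.range M, (b k / l k) ^ p ≤ 1)
    (h : ∀ N, n < N → ((N - n : ℕ) : ℝ) ^ (1 / q) * invPowSum l p N ^ (-(1 / p)) ≤ R) (M : ℕ) :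
    ∑ k ∈ Finset.Ico n M, b k ^ q ≤ R ^ q := by
  have hq : 0 < q := hp.trans_le hpq
  have hθ : 1 ≤ q / p := by rwa [one_le_div hp]
  have hanti : ∀ {r : ℝ}, 0 ≤ r → Antitone fun k => b k ^ r := fun hr i j hij =>
    Real.rpow_le_rpow (hb0 j) (hb hij) hr
  have hpart : ∀ N, ((N - n : ℕ) : ℝ) ≤ R ^ q * invPowSum l p N ^ (q / p) := by
    intro N
    rcases le_or_gt N n with hN | hN
    · rw [Nat.sub_eq_zero_of_le hN]
      have := invPowSum_nonneg hl p N
      push_cast; positivity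
    · have hW := invPowSum_pos hl p (Nat.zero_lt_of_lt hN)
      have h1 := Real.rpow_le_rpow (by positivity) (h N hN) hq.le
      rw [Real.mul_rpow (by positivity) (by positivity), ← Real.rpow_mul (by positivity),
        ← Real.rpow_mul hW.le, one_div_mul_cancel hq.ne', Real.rpow_one,
        show -(1 / p) * q = -(q / p) by ring, Real.rpow_neg hW.le, ← div_eq_mul_inv,
        div_le_iff₀ (by positivity)] at h1
      exact h1
  rw [sum_Ico_eq_sum_range_ite]
  calc _ ≤ ∑ k ∈ Finset.range M, b k ^ q *
        (R ^ q * (invPowSum l p (k + 1) ^ (q / p) - invPowSum l p k ^ (q / p))) := by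
        refine sum_mul_le_sum_mul_of_antitone (hanti hq.le)
          (fun k => Real.rpow_nonneg (hb0 k) _) (fun m => ?_) M
        rw [sum_range_ite_le, ← Finset.mul_sum,
          Finset.sum_range_sub fun k => invPowSum l p k ^ (q / p)]
        have h0 : invPowSum l p 0 ^ (q / p) = 0 := by
          simp [invPowSum, Real.zero_rpow (by linarith : q / p ≠ 0)]
        rw [h0, sub_zero]
        exact hpart m
    _ = R ^ q * ∑ k ∈ Finset.range M, (b k ^ p) ^ (q / p) *
        (invPowSum l p (k + 1) ^ (q / p) - invPowSum l p k ^ (q / p)) := by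
        rw [Finset.mul_sum]
        refine Finset.sum_congr rfl fun k _ => ?_
        rw [← Real.rpow_mul (hb0 k), mul_div_cancel₀ _ hp.ne']
        ring
    _ ≤ R ^ q * (∑ k ∈ Finset.range M, b k ^ p * l k ^ (-p)) ^ (q / p) := by
        gcongr
        exact sum_rpow_mul_sub_le hθ (hanti hp.le) (fun k => Real.rpow_nonneg (hb0 k) _)
          (fun k => Real.rpow_nonneg (hl k).le _) M
    _ ≤ R ^ q * 1 := by
        gcongr
        refine Real.rpow_le_one (Finset.sum_nonneg fun k _ => mul_nonneg
          (Real.rpow_nonneg (hb0 k) _) (Real.rpow_nonneg (hl k).le _)) ?_ (by positivity)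
        refine le_trans (le_of_eq (Finset.sum_congr rfl fun k _ => ?_)) (hball M)
        rw [Real.div_rpow (hb0 k) (hl k).le, Real.rpow_neg (hl k).le, div_eq_mul_inv]
    _ = R ^ q := mul_one _

/-- The case `q = ∞` of `sum_Ico_rpow_le_of_le`. -/
theorem apply_le_of_sum_rpow_le {l b : ℕ → ℝ} (hl : ∀ k, 0 < l k) (hb : Antitone b)
    (hb0 : ∀ k, 0 ≤ b k) {p R : ℝ} (hp : 0 < p) {n : ℕ}
    (hball : ∀ M, ∑ k ∈ Finset.range M, (b k / l k) ^ p ≤ 1)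
    (h : invPowSum l p (n + 1) ^ (-(1 / p)) ≤ R) : b n ≤ R := by
  refine le_trans ?_ h
  have hW := invPowSum_pos hl p n.succ_pos
  have h1 : b n ^ p * invPowSum l p (n + 1) ≤ 1 := by
    refine le_trans ?_ (hball (n + 1))
    rw [invPowSum, Finset.mul_sum]
    refine Finset.sum_le_sum fun k hk => ?_
    rw [Real.div_rpow (hb0 k) (hl k).le, Real.rpow_neg (hl k).le, div_eq_mul_inv]
    have := hl k
    gcongr
    · exact hb0 n
    · exact hb (Nat.lt_succ_iff.1 (Finset.mem_range.1 hk))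
  rw [← le_div_iff₀ hW] at h1
  have h2 := Real.rpow_le_rpow (Real.rpow_nonneg (hb0 n) _) h1 (one_div_nonneg.2 hp.le)
  rwa [← Real.rpow_mul (hb0 n), mul_one_div_cancel hp.ne', Real.rpow_one, one_div (invPowSum _ _ _),
    Real.inv_rpow hW.le, ← Real.rpow_neg hW.le] at h2

/-- The tail of a nonincreasing sequence in the weighted `ℓ_p` ball, for `q < p < ∞`: the indicator
of `k ≥ n` is majorized, in the sense of partial sums, by the weight equal to `A l_k^{-p}` for
`k < N` and to `1` for `k ≥ N`, to which Hölder's inequality is applied. -/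
theorem sum_Ico_rpow_le_of_lt {l b : ℕ → ℝ} (hl : ∀ k, 0 < l k) (hb : Antitone b)
    (hb0 : ∀ k, 0 ≤ b k) {p q r A : ℝ} (hq : 0 < q) (hr : 0 < r) (hpqr : 1 / r = 1 / q - 1 / p)
    (hp : 0 < p) (hA : 0 ≤ A) {n : ℕ} (N : ℕ)
    (hball : ∀ M, ∑ k ∈ Finset.range M, (b k / l k) ^ p ≤ 1)
    (h : ∀ m, n < m → ((m - n : ℕ) : ℝ) ≤ A * invPowSum l p m)
    (hsum : Summable fun k => l k ^ r) (M : ℕ) :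
    ∑ k ∈ Finset.Ico n M, b k ^ q ≤
      (A ^ (r / q) * invPowSum l p N + ∑' k, l (k + N) ^ r) ^ (q / r) := by
  have hpart : ∀ m, ((m - n : ℕ) : ℝ) ≤ A * invPowSum l p m := fun m => by
    rcases le_or_gt m n with hm | hm
    · rw [Nat.sub_eq_zero_of_le hm]
      have := invPowSum_nonneg hl p m
      push_cast; positivity
    · exact h m hm
  set w : ℕ → ℝ := fun k => if k < N then A * l k ^ (-p) else 1 with hw
  have hw0 : ∀ k, 0 ≤ w k := fun k => by
    have := hl k
    simp only [hw]; split_ifs <;> positivity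
  have hwN : ∀ m, m ≤ N → ∑ k ∈ Finset.range m, w k = A * invPowSum l p m := fun m hm => by
    rw [invPowSum, Finset.mul_sum]
    refine Finset.sum_congr rfl fun k hk => ?_
    simp only [hw, if_pos ((Finset.mem_range.1 hk).trans_le hm)]
  have hwpart : ∀ m, ((m - n : ℕ) : ℝ) ≤ ∑ k ∈ Finset.range m, w k := by
    intro m
    rcases le_total m N with hm | hm
    · rw [hwN m hm]; exact hpart m
    · rw [← Finset.sum_range_add_sum_Ico _ hm, hwN N le_rfl]
      have h1 : ∑ k ∈ Finset.Ico N m, w k = ((m - N : ℕ) : ℝ) := by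
        rw [Finset.sum_congr rfl fun k hk => show w k = 1 by
          simp only [hw, if_neg (not_lt.2 (Finset.mem_Ico.1 hk).1)]]
        simp
      rw [h1]
      have h2 : ((m - n : ℕ) : ℝ) ≤ ((N - n : ℕ) : ℝ) + ((m - N : ℕ) : ℝ) := by
        exact_mod_cast (by omega)
      linarith [hpart N]
  have hconj : (r / q).HolderConjugate (p / q) := by
    have h1 : q / r + q / p = 1 := by
      have := congrArg (q * ·) hpqr
      simp only [mul_sub, mul_one_div, div_self hq.ne'] at this
      linarith
    rw [Real.holderConjugate_iff]
    refine ⟨?_, by rw [inv_div, inv_div]; exact h1⟩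
    rw [one_lt_div hq]
    have : 0 < q / p := by positivity
    exact (div_lt_one hr).1 (by linarith)
  rw [sum_Ico_eq_sum_range_ite]
  have hexp : (q - p) * (r / q) = -p := by
    field_simp at hpqr ⊢
    linarith
  have hterm : ∑ k ∈ Finset.range M, (w k * l k ^ q) ^ (r / q) ≤
      A ^ (r / q) * invPowSum l p N + ∑' k, l (k + N) ^ r := by
    have hnn : ∀ k, 0 ≤ (w k * l k ^ q) ^ (r / q) := fun k =>
      Real.rpow_nonneg (mul_nonneg (hw0 k) (Real.rpow_nonneg (hl k).le _)) _
    calc _ ≤ ∑ k ∈ Finset.range (N + M), (w k * l k ^ q) ^ (r / q) :=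
          Finset.sum_le_sum_of_subset_of_nonneg
            (Finset.range_mono (Nat.le_add_left M N)) fun k _ _ => hnn k
      _ = ∑ k ∈ Finset.range N, (w k * l k ^ q) ^ (r / q) +
          ∑ k ∈ Finset.range M, (w (N + k) * l (N + k) ^ q) ^ (r / q) :=
          Finset.sum_range_add _ _ _
      _ = A ^ (r / q) * invPowSum l p N + ∑ k ∈ Finset.range M, l (k + N) ^ r := by
          congr 1
          · rw [invPowSum, Finset.mul_sum]
            refine Finset.sum_congr rfl fun k hk => ?_
            simp only [hw, if_pos (Finset.mem_range.1 hk)]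
            rw [mul_assoc, ← Real.rpow_add (hl k), Real.mul_rpow hA (Real.rpow_nonneg (hl k).le _),
              ← Real.rpow_mul (hl k).le, show -p + q = q - p by ring, hexp]
          · refine Finset.sum_congr rfl fun k _ => ?_
            simp only [hw, if_neg (not_lt.2 (Nat.le_add_right N k))]
            rw [one_mul, ← Real.rpow_mul (hl _).le, mul_div_cancel₀ _ hq.ne', add_comm]
      _ ≤ _ := by
          gcongr
          exact ((summable_nat_add_iff N).2 hsum).sum_le_tsum _
            fun k _ => Real.rpow_nonneg (hl _).le _
  calc _ ≤ ∑ k ∈ Finset.range M, b k ^ q * w k :=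
        sum_mul_le_sum_mul_of_antitone (fun i j hij => Real.rpow_le_rpow (hb0 j) (hb hij) hq.le)
          (fun k => Real.rpow_nonneg (hb0 k) _)
          (fun m => by rw [sum_range_ite_le]; exact hwpart m) M
    _ = ∑ k ∈ Finset.range M, (w k * l k ^ q) * (b k / l k) ^ q := by
        refine Finset.sum_congr rfl fun k _ => ?_
        have := Real.rpow_pos_of_pos (hl k) q
        rw [Real.div_rpow (hb0 k) (hl k).le]
        field_simp
    _ ≤ (∑ k ∈ Finset.range M, (w k * l k ^ q) ^ (r / q)) ^ (1 / (r / q)) *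
        (∑ k ∈ Finset.range M, ((b k / l k) ^ q) ^ (p / q)) ^ (1 / (p / q)) :=
        Real.inner_le_Lp_mul_Lq_of_nonneg _ hconj
          (fun k _ => mul_nonneg (hw0 k) (Real.rpow_nonneg (hl k).le _))
          (fun k _ => Real.rpow_nonneg (div_nonneg (hb0 k) (hl k).le) _)
    _ ≤ (A ^ (r / q) * invPowSum l p N + ∑' k, l (k + N) ^ r) ^ (1 / (r / q)) * 1 := by
        have h0 : ∀ k, 0 ≤ b k / l k := fun k => div_nonneg (hb0 k) (hl k).le
        refine mul_le_mul (Real.rpow_le_rpow (Finset.sum_nonneg fun k _ =>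
          Real.rpow_nonneg (mul_nonneg (hw0 k) (Real.rpow_nonneg (hl k).le _)) _) hterm
          (by positivity)) ?_ (Real.rpow_nonneg (Finset.sum_nonneg fun k _ =>
          Real.rpow_nonneg (Real.rpow_nonneg (h0 k) _) _) _) (Real.rpow_nonneg (add_nonneg
          (mul_nonneg (Real.rpow_nonneg hA _) (invPowSum_nonneg hl p N))
          (tsum_nonneg fun k => Real.rpow_nonneg (hl _).le _)) _)
        refine Real.rpow_le_one (Finset.sum_nonneg fun k _ =>
          Real.rpow_nonneg (Real.rpow_nonneg (h0 k) _) _) ?_ (by positivity)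
        refine le_trans (le_of_eq (Finset.sum_congr rfl fun k _ => ?_)) (hball M)
        rw [← Real.rpow_mul (h0 k), mul_div_cancel₀ _ hq.ne']
    _ = _ := by rw [mul_one, one_div_div]

/-! ### Fourier coefficients on the torus -/

/-- The trigonometric monomial as an element of `L_1(𝕋^d)`. -/
noncomputable def trigMonomialL1 {d : ℕ} (k : Fin d → ℤ) : TorusL1 d :=
  ContinuousMap.toLp (E := ℂ) 1 (torusMeasure d) ℂ (trigMonomial k)

lemma integrable_mul_trigMonomial {d : ℕ} (f : TorusL1 d) (k : Fin d → ℤ) :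
    Integrable (fun x => f x * trigMonomial k x) (torusMeasure d) := by
  refine (L1.integrable_coeFn f).mul_bdd (c := ‖trigMonomial k‖)
    (trigMonomial k).continuous.aestronglyMeasurable
    (Eventually.of_forall fun x => (trigMonomial k).norm_coe_le_norm x)

/-- The `k`-th Fourier coefficient as a linear functional on `L_1(𝕋^d)`. -/
noncomputable def torusFourierCoeffₗ {d : ℕ} (k : Fin d → ℤ) : TorusL1 d →ₗ[ℂ] ℂ where
  toFun f := torusFourierCoeff f k
  map_add' f g := by
    unfold torusFourierCoeff
    rw [← integral_add (integrable_mul_trigMonomial f _) (integrable_mul_trigMonomial g _)]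
    refine integral_congr_ae ?_
    filter_upwards [Lp.coeFn_add f g] with x hx
    rw [hx, Pi.add_apply, add_mul]
  map_smul' c f := by
    unfold torusFourierCoeff
    rw [RingHom.id_apply, smul_eq_mul, ← integral_const_mul]
    refine integral_congr_ae ?_
    filter_upwards [Lp.coeFn_smul c f] with x hx
    rw [hx, Pi.smul_apply, smul_eq_mul, mul_assoc]

lemma torusFourierCoeff_trigMonomialL1 {d : ℕ} (l k : Fin d → ℤ) :
    torusFourierCoeff (trigMonomialL1 l) k = if k = l then 1 else 0 := by
  have h1 : torusFourierCoeff (trigMonomialL1 l) k =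
      ∫ x, ∏ i, (fourier (-(k i)) (x i) * fourier (l i) (x i) : ℂ) ∂(torusMeasure d) := by
    unfold torusFourierCoeff trigMonomialL1
    refine integral_congr_ae ?_
    filter_upwards [ContinuousMap.coeFn_toLp (p := 1) (𝕜 := ℂ) (torusMeasure d)
      (trigMonomial l)] with x hx
    rw [hx, Finset.prod_mul_distrib, mul_comm]
    rfl
  have h2 (i : Fin d) : ∫ t : AddCircle (2 * Real.pi),
      (fourier (-(k i)) t * fourier (l i) t : ℂ) ∂AddCircle.haarAddCircle =
      if k i = l i then 1 else 0 := by
    have := congrFun (fourierCoeff_fourier (T := 2 * Real.pi) (l i)) (k i)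
    rw [Pi.single_apply] at this
    exact this
  rw [h1, torusMeasure, integral_fintype_prod_eq_prod
    (fun i (t : AddCircle (2 * Real.pi)) => (fourier (-(k i)) t * fourier (l i) t : ℂ))]
  simp_rw [h2]
  rw [Finset.prod_ite_zero]
  simp [funext_iff]

lemma torusFourierCoeff_sub_sum {d n : ℕ} (f : TorusL1 d) (a : Fin n → ℂ) (y : Fin n → TorusL1 d)
    (k : Fin d → ℤ) :
    torusFourierCoeff (f - ∑ j, a j • y j) k =
      torusFourierCoeff f k - ∑ j, a j * torusFourierCoeff (y j) k := by
  change torusFourierCoeffₗ k _ = _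
  rw [map_sub, map_sum]
  simp only [map_smul]
  rfl

lemma torusFourierCoeff_sum_smul_trigMonomialL1 {d : ℕ} {e : ℕ → Fin d → ℤ}
    (he : Function.Injective e) (c : ℕ → ℂ) (M m : ℕ) :
    torusFourierCoeff (∑ j ∈ Finset.range M, c j • trigMonomialL1 (e j)) (e m) =
      if m < M then c m else 0 := by
  change torusFourierCoeffₗ (e m) _ = _
  rw [map_sum]
  have h : ∀ j, torusFourierCoeffₗ (e m) (c j • trigMonomialL1 (e j)) =
      if m = j then c j else 0 := by
    intro j
    rw [map_smul]
    change c j • torusFourierCoeff (trigMonomialL1 (e j)) (e m) = _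
    rw [torusFourierCoeff_trigMonomialL1]
    simp [he.eq_iff]
  simp only [h]
  rw [Finset.sum_ite_eq]
  simp

/-! ### The width and nonincreasing sequences -/

lemma ellNorm_comp_of_injective {ι : Type*} {p : ℝ≥0∞} (hp : p ≠ 0) {a : ι → ℂ} {j : ℕ → ι}
    (hj : Function.Injective j) (ha : ∀ k ∉ Set.range j, a k = 0) :
    ellNorm p a = ellNorm p fun m => a (j m) := by
  unfold ellNorm
  split_ifs with h
  · refine le_antisymm (iSup_le fun k => ?_) (iSup_le fun m => le_iSup (fun k => ‖a k‖ₑ) (j m))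
    by_cases hk : k ∈ Set.range j
    · obtain ⟨m, rfl⟩ := hk
      exact le_iSup (fun m => ‖a (j m)‖ₑ) m
    · simp [ha k hk]
  · have hsupp : (Function.support fun k => ‖a k‖ₑ ^ p.toReal) ⊆ Set.range j := by
      intro k hk
      by_contra hk'
      exact hk (by simp [ha k hk', ENNReal.toReal_pos hp h])
    rw [hj.tsum_eq hsupp]

lemma sum_enorm_rpow {ι : Type*} {p : ℝ} (hp : 0 < p) (a : ι → ℂ) (S : Finset ι) :
    ∑ k ∈ S, ‖a k‖ₑ ^ p = ENNReal.ofReal (∑ k ∈ S, ‖a k‖ ^ p) := by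
  rw [ENNReal.ofReal_sum_of_nonneg fun k _ => by positivity]
  refine Finset.sum_congr rfl fun k _ => ?_
  rw [← ofReal_norm, ENNReal.ofReal_rpow_of_nonneg (norm_nonneg _) hp.le]

lemma ellNorm_ofReal {ι : Type*} {p : ℝ} (hp : 0 < p) (a : ι → ℂ) :
    ellNorm (ENNReal.ofReal p) a = (∑' k, ‖a k‖ₑ ^ p) ^ (1 / p) := by
  rw [ellNorm, if_neg ENNReal.ofReal_ne_top, ENNReal.toReal_ofReal hp.le]

lemma ellNorm_ofReal_le_iff {ι : Type*} {p R : ℝ} (hp : 0 < p) (hR : 0 ≤ R) (a : ι → ℂ) :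
    ellNorm (ENNReal.ofReal p) a ≤ ENNReal.ofReal R ↔
      ∀ S : Finset ι, ∑ k ∈ S, ‖a k‖ ^ p ≤ R ^ p := by
  rw [ellNorm_ofReal hp, one_div, ENNReal.rpow_inv_le_iff hp, ENNReal.tsum_eq_iSup_sum, iSup_le_iff]
  refine forall_congr' fun S => ?_
  rw [sum_enorm_rpow hp, ENNReal.ofReal_rpow_of_nonneg hR hp.le,
    ENNReal.ofReal_le_ofReal_iff (by positivity)]

lemma ofReal_sum_rpow_le_ellNorm {ι : Type*} {p : ℝ} (hp : 0 < p) (a : ι → ℂ) (S : Finset ι) :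
    ENNReal.ofReal ((∑ k ∈ S, ‖a k‖ ^ p) ^ (1 / p)) ≤ ellNorm (ENNReal.ofReal p) a := by
  rw [ellNorm_ofReal hp, ← ENNReal.ofReal_rpow_of_nonneg
      (Finset.sum_nonneg fun k _ => by positivity)
    (by positivity), ← sum_enorm_rpow hp]
  gcongr
  exact ENNReal.sum_le_tsum S

lemma ellNorm_top_le_iff {ι : Type*} {R : ℝ} (hR : 0 ≤ R) (a : ι → ℂ) :
    ellNorm ∞ a ≤ ENNReal.ofReal R ↔ ∀ k, ‖a k‖ ≤ R := by
  rw [ellNorm, if_pos rfl, iSup_le_iff]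
  refine forall_congr' fun k => ?_
  rw [← ofReal_norm, ENNReal.ofReal_le_ofReal_iff hR]

lemma ofReal_norm_le_ellNorm_top {ι : Type*} (a : ι → ℂ) (k : ι) :
    ENNReal.ofReal ‖a k‖ ≤ ellNorm ∞ a := by
  rw [ellNorm, if_pos rfl, ofReal_norm]
  exact le_iSup (fun k => ‖a k‖ₑ) k

lemma norm_weight_mul {ι : Type*} {ω : ι → ℝ} (hpos : ∀ k, 0 < ω k) (k : ι) (z : ℂ) :
    ‖(ω k : ℂ) * z‖ = ω k * ‖z‖ := by
  rw [norm_mul, Complex.norm_real, Real.norm_of_nonneg (hpos k).le]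

lemma tendsto_norm_of_le_inv {ι : Type*} {ω : ι → ℝ} (hpos : ∀ k, 0 < ω k)
    (hω : Tendsto ω cofinite atTop) {a : ι → ℂ} (ha : ∀ k, ω k * ‖a k‖ ≤ 1) :
    Tendsto (fun k => ‖a k‖) cofinite (𝓝 0) := by
  refine squeeze_zero (fun k => norm_nonneg _) (fun k => ?_) (tendsto_inv_atTop_zero.comp hω)
  rw [Function.comp_apply, ← one_div, le_div_iff₀ (hpos k), mul_comm]
  exact ha k

/-- The `n`-term approximant built from the `n` largest Fourier coefficients. -/
lemma bestTermError_le {d : ℕ} {q : ℝ≥0∞} (hq : q ≠ 0) (f : TorusL1 d) {e : ℕ → Fin d → ℤ}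
    (he : Function.Injective e) (h0 : ∀ k ∉ Set.range e, ‖torusFourierCoeff f k‖ = 0) (n : ℕ) :
    bestTermError (weightedNorm (fun _ => 1) q) (trigSystem d) n f ≤
      ellNorm q fun m => torusFourierCoeff f (e (m + n)) := by
  refine (iInf₂_le (fun j : Fin n => torusFourierCoeff f (e j))
    (fun j : Fin n => (⟨trigMonomialL1 (e j), ⟨e j, rfl⟩⟩ : trigSystem d))).trans ?_
  have hcoef : ∀ k, torusFourierCoeff (f - ∑ j : Fin n, torusFourierCoeff f (e j) •
      trigMonomialL1 (e j)) k =
      if k ∈ (Finset.range n).image e then 0 else torusFourierCoeff f k := by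
    intro k
    rw [torusFourierCoeff_sub_sum,
      Fin.sum_univ_eq_sum_range (fun j => torusFourierCoeff f (e j) *
        torusFourierCoeff (trigMonomialL1 (e j)) k) n]
    simp only [torusFourierCoeff_trigMonomialL1, mul_ite, mul_one, mul_zero]
    split_ifs with hk
    · obtain ⟨m, hm, rfl⟩ := Finset.mem_image.1 hk
      simp only [he.eq_iff, Finset.sum_ite_eq, if_pos hm, sub_self]
    · rw [Finset.sum_eq_zero, sub_zero]
      intro j hj
      rw [if_neg]
      rintro rfl
      exact hk (Finset.mem_image_of_mem e hj)
  change weightedNorm (fun _ => 1) q (f - ∑ j : Fin n, torusFourierCoeff f (e j) •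
      trigMonomialL1 (e j)) ≤ _
  unfold weightedNorm
  simp only [hcoef, Complex.ofReal_one, one_mul]
  rw [ellNorm_comp_of_injective (j := fun m => e (m + n)) hq
    (fun a b hab => Nat.add_right_cancel (he hab))]
  · refine le_of_eq (congrArg _ (funext fun m => if_neg ?_))
    simp [he.eq_iff]
  · intro k hk
    split_ifs with hk'
    · rfl
    · by_cases hr : k ∈ Set.range e
      · obtain ⟨m, rfl⟩ := hr
        exfalso
        rcases lt_or_ge m n with hm | hm
        · exact hk' (Finset.mem_image_of_mem e (Finset.mem_range.2 hm))
        · exact hk ⟨m - n, by simp [Nat.sub_add_cancel hm]⟩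
      · simpa using h0 k hr

section Width

variable {d : ℕ} {ω : (Fin d → ℤ) → ℝ}

lemma termWidth_le {p q R : ℝ≥0∞} (hd : 1 ≤ d) (hq : q ≠ 0) {n : ℕ}
    (hdecay : ∀ f : TorusL1 d, weightedNorm ω p f ≤ 1 →
      Tendsto (fun k => ‖torusFourierCoeff f k‖) cofinite (𝓝 0))
    (h : ∀ f : TorusL1 d, weightedNorm ω p f ≤ 1 → ∀ e : ℕ → Fin d → ℤ, Function.Injective e →
      (Antitone fun m => ‖torusFourierCoeff f (e m)‖) →
      ellNorm q (fun m => torusFourierCoeff f (e (m + n))) ≤ R) :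
    termWidth ω p q n ≤ R := by
  have : Nonempty (Fin d) := ⟨⟨0, hd⟩⟩
  refine iSup₂_le fun f hf => ?_
  obtain ⟨e, he, hanti, h0⟩ := exists_antitone_enumeration (fun k => norm_nonneg _) (hdecay f hf.2)
  exact (bestTermError_le hq f he h0 n).trans (h f hf.2 e he hanti)

lemma sum_rpow_le_one_of_weightedNorm_le (hpos : ∀ k, 0 < ω k) {p : ℝ} (hp : 0 < p) {f : TorusL1 d}
    (hf : weightedNorm ω (ENNReal.ofReal p) f ≤ 1) (S : Finset (Fin d → ℤ)) :
    ∑ k ∈ S, (ω k * ‖torusFourierCoeff f k‖) ^ p ≤ 1 := by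
  have := (ellNorm_ofReal_le_iff hp zero_le_one _).1 (hf.trans ENNReal.ofReal_one.ge) S
  simpa only [norm_weight_mul hpos, Real.one_rpow] using this

lemma weight_mul_norm_le_one (hpos : ∀ k, 0 < ω k) {p : ℝ} (hp : 0 < p) {f : TorusL1 d}
    (hf : weightedNorm ω (ENNReal.ofReal p) f ≤ 1) (k : Fin d → ℤ) :
    ω k * ‖torusFourierCoeff f k‖ ≤ 1 := by
  have := sum_rpow_le_one_of_weightedNorm_le hpos hp hf {k}
  rw [Finset.sum_singleton] at this
  rwa [← Real.one_rpow p, Real.rpow_le_rpow_iff (mul_nonneg (hpos k).le (norm_nonneg _))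
    zero_le_one hp] at this

/-- The rearrangement inequality: pairing the decreasing rearrangement of the coefficients with the
increasing rearrangement of the weight does not increase the norm. -/
lemma sum_range_div_rpow_le_one (hpos : ∀ k, 0 < ω k) {e : ℕ ≃ (Fin d → ℤ)}
    (hanti : Antitone fun m => 1 / ω (e m)) {p : ℝ} (hp : 0 < p) {f : TorusL1 d}
    (hf : weightedNorm ω (ENNReal.ofReal p) f ≤ 1) {j : ℕ → Fin d → ℤ} (hj : Function.Injective j)
    (hjanti : Antitone fun m => ‖torusFourierCoeff f (j m)‖) (M : ℕ) :
    ∑ m ∈ Finset.range M, (‖torusFourierCoeff f (j m)‖ / (1 / ω (e m))) ^ p ≤ 1 := by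
  have hmono : Monotone fun m => ω (e m) ^ p := fun a b hab =>
    Real.rpow_le_rpow (hpos _).le
      ((one_div_le_one_div (hpos _) (hpos _)).1 (hanti hab)) hp.le
  calc _ = ∑ m ∈ Finset.range M, ‖torusFourierCoeff f (j m)‖ ^ p * ω (e m) ^ p := by
        refine Finset.sum_congr rfl fun m _ => ?_
        rw [div_div_eq_mul_div, div_one, Real.mul_rpow (norm_nonneg _) (hpos _).le]
    _ ≤ ∑ m ∈ Finset.range M, ‖torusFourierCoeff f (j m)‖ ^ p * ω (e (e.symm (j m))) ^ p :=
        sum_mul_le_sum_mul_of_antitone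
          (fun a b hab => Real.rpow_le_rpow (norm_nonneg _) (hjanti hab) hp.le)
          (fun m => Real.rpow_nonneg (norm_nonneg _) _)
          (fun N => sum_range_le_sum_comp_of_injective hmono (e.symm.injective.comp hj) N) M
    _ = ∑ k ∈ (Finset.range M).image j, (ω k * ‖torusFourierCoeff f k‖) ^ p := by
        rw [Finset.sum_image hj.injOn]
        refine Finset.sum_congr rfl fun m _ => ?_
        rw [e.apply_symm_apply, Real.mul_rpow (hpos _).le (norm_nonneg _), mul_comm]
    _ ≤ 1 := sum_rpow_le_one_of_weightedNorm_le hpos hp hf _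

lemma sum_div_rpow_le_of_le {l l' b : ℕ → ℝ} (hl : ∀ k, 0 < l k) (hll : ∀ k, l k ≤ l' k)
    (hb : ∀ k, 0 ≤ b k) {p : ℝ} (hp : 0 < p) (S : Finset ℕ) :
    ∑ k ∈ S, (b k / l' k) ^ p ≤ ∑ k ∈ S, (b k / l k) ^ p :=
  Finset.sum_le_sum fun k _ => Real.rpow_le_rpow (div_nonneg (hb k) ((hl k).le.trans (hll k)))
    (div_le_div_of_nonneg_left (hb k) (hl k) (hll k)) hp.le

/-- An upper bound for the width from a bound for the tails of nonincreasing sequences in a weighted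
`ℓ_p` ball. The weights `1 / l` may be smaller than the rearranged weights and need not be
monotone. -/
lemma termWidth_le_of_sum_Ico_le (hd : 1 ≤ d) (hpos : ∀ k, 0 < ω k) (hω : Tendsto ω cofinite atTop)
    {e : ℕ ≃ (Fin d → ℤ)} (hanti : Antitone fun m => 1 / ω (e m)) {l : ℕ → ℝ}
    (hl : ∀ m, 1 / ω (e m) ≤ l m) {p q R : ℝ} (hp : 0 < p) (hq : 0 < q) (hR : 0 ≤ R) {n : ℕ}
    (h : ∀ b : ℕ → ℝ, Antitone b → (∀ k, 0 ≤ b k) →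
      (∀ M, ∑ k ∈ Finset.range M, (b k / l k) ^ p ≤ 1) →
      ∀ M, ∑ k ∈ Finset.Ico n M, b k ^ q ≤ R ^ q) :
    termWidth ω (ENNReal.ofReal p) (ENNReal.ofReal q) n ≤ ENNReal.ofReal R := by
  refine termWidth_le hd (by simpa using hq) (fun f hf => tendsto_norm_of_le_inv hpos hω
    (weight_mul_norm_le_one hpos hp hf)) fun f hf j hj hjanti => ?_
  rw [ellNorm_ofReal_le_iff hq hR]
  intro S
  have hball := sum_range_div_rpow_le_one hpos hanti hp hf hj hjanti
  obtain ⟨M, hM⟩ := S.exists_nat_subset_range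
  refine le_trans ?_ (h _ hjanti (fun k => norm_nonneg _) (fun M => (sum_div_rpow_le_of_le
    (fun k => one_div_pos.2 (hpos _)) hl (fun k => norm_nonneg _) hp _).trans (hball M)) (n + M))
  rw [Finset.sum_Ico_eq_sum_range, Nat.add_sub_cancel_left]
  refine (Finset.sum_le_sum_of_subset_of_nonneg hM fun k _ _ =>
    Real.rpow_nonneg (norm_nonneg _) _).trans (le_of_eq (Finset.sum_congr rfl fun k _ => ?_))
  rw [add_comm]

lemma termWidth_top_le_of_apply_le (hd : 1 ≤ d) (hpos : ∀ k, 0 < ω k)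
    (hω : Tendsto ω cofinite atTop) {e : ℕ ≃ (Fin d → ℤ)} (hanti : Antitone fun m => 1 / ω (e m))
    {l : ℕ → ℝ} (hl : ∀ m, 1 / ω (e m) ≤ l m) {p R : ℝ} (hp : 0 < p) (hR : 0 ≤ R) {n : ℕ}
    (h : ∀ b : ℕ → ℝ, Antitone b → (∀ k, 0 ≤ b k) →
      (∀ M, ∑ k ∈ Finset.range M, (b k / l k) ^ p ≤ 1) → b n ≤ R) :
    termWidth ω (ENNReal.ofReal p) ∞ n ≤ ENNReal.ofReal R := by
  refine termWidth_le hd ENNReal.top_ne_zero (fun f hf => tendsto_norm_of_le_inv hpos hω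
    (weight_mul_norm_le_one hpos hp hf)) fun f hf j hj hjanti => ?_
  rw [ellNorm_top_le_iff hR]
  have hball := sum_range_div_rpow_le_one hpos hanti hp hf hj hjanti
  exact fun k => (hjanti (Nat.le_add_left n k)).trans (h _ hjanti (fun k => norm_nonneg _)
    fun M => (sum_div_rpow_le_of_le (fun k => one_div_pos.2 (hpos _)) hl
      (fun k => norm_nonneg _) hp _).trans (hball M))

lemma termWidth_top_top_le (hd : 1 ≤ d) (hpos : ∀ k, 0 < ω k) (hω : Tendsto ω cofinite atTop)
    {e : ℕ ≃ (Fin d → ℤ)} (hanti : Antitone fun m => 1 / ω (e m)) (n : ℕ) :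
    termWidth ω ∞ ∞ n ≤ ENNReal.ofReal (1 / ω (e n)) := by
  have hle : ∀ f : TorusL1 d, weightedNorm ω ∞ f ≤ 1 → ∀ k, ω k * ‖torusFourierCoeff f k‖ ≤ 1 :=
    fun f hf k => by
      have := (ellNorm_top_le_iff zero_le_one _).1 (hf.trans ENNReal.ofReal_one.ge) k
      rwa [norm_weight_mul hpos] at this
  refine termWidth_le hd ENNReal.top_ne_zero (fun f hf => tendsto_norm_of_le_inv hpos hω
    (hle f hf)) fun f hf j hj hjanti => ?_
  rw [ellNorm_top_le_iff (one_div_pos.2 (hpos _)).le]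
  intro m
  -- Among `n + 1` distinct frequencies, one has rank at least `n`.
  obtain ⟨i, hi, hni⟩ : ∃ i ∈ Finset.range (n + 1), n ≤ e.symm (j i) := by
    by_contra! hcon
    have := Finset.card_le_card_of_injOn (s := Finset.range (n + 1)) (t := Finset.range n)
      (fun i => e.symm (j i)) (fun i hi => by simpa using hcon i (by simpa using hi))
      (e.symm.injective.comp hj).injOn
    simp at this
  calc ‖torusFourierCoeff f (j (m + n))‖ ≤ ‖torusFourierCoeff f (j i)‖ :=
        hjanti (by have := Finset.mem_range.1 hi; omega)
    _ ≤ 1 / ω (e (e.symm (j i))) := by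
        rw [e.apply_symm_apply, le_div_iff₀ (hpos _), mul_comm]
        exact hle f hf _
    _ ≤ 1 / ω (e n) := hanti hni

/-- The width is bounded below by testing with a trigonometric polynomial whose frequencies are the
first `M` members of the list `e`. -/
lemma le_termWidth {p q R : ℝ≥0∞} (hp : p ≠ 0) (e : ℕ ≃ (Fin d → ℤ)) (b : ℕ → ℝ) (M n : ℕ)
    (hb : ellNorm p (fun m => (ω (e m) : ℂ) * if m < M then (b m : ℂ) else 0) ≤ 1)
    (h : ∀ (T : Finset ℕ) (g : (Fin d → ℤ) → ℂ), T.card ≤ n →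
      (∀ m < M, m ∉ T → g (e m) = b m) → R ≤ ellNorm q g) :
    R ≤ termWidth ω p q n := by
  classical
  set f : TorusL1 d := ∑ j ∈ Finset.range M, (b j : ℂ) • trigMonomialL1 (e j) with hf
  have hcoef : ∀ m, torusFourierCoeff f (e m) = if m < M then (b m : ℂ) else 0 :=
    torusFourierCoeff_sum_smul_trigMonomialL1 e.injective _ M
  have hnorm : weightedNorm ω p f ≤ 1 := by
    unfold weightedNorm
    rw [ellNorm_comp_of_injective hp e.injective (fun k hk => absurd (e.surjective k) hk)]
    simpa only [hcoef] using hb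
  refine le_iSup₂_of_le f ⟨hnorm.trans_lt ENNReal.one_lt_top, hnorm⟩ ?_
  refine le_iInf₂ fun a y => ?_
  choose k hk using fun j => (y j).2
  refine h ((Finset.univ : Finset (Fin n)).image fun j => e.symm (k j)) _
    (Finset.card_image_le.trans (by simp)) fun m hm hmT => ?_
  rw [torusFourierCoeff_sub_sum, hcoef, if_pos hm, Finset.sum_eq_zero, sub_zero]
  · simp
  · intro j _
    rw [← hk j]
    change a j * torusFourierCoeff (trigMonomialL1 (k j)) (e m) = 0
    rw [torusFourierCoeff_trigMonomialL1, if_neg, mul_zero]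
    rintro h
    exact hmT (Finset.mem_image.2 ⟨j, Finset.mem_univ _, by rw [← h, e.symm_apply_apply]⟩)

lemma ellNorm_truncate_le_one (hpos : ∀ k, 0 < ω k) (e : ℕ ≃ (Fin d → ℤ)) {b : ℕ → ℝ}
    (hb0 : ∀ m, 0 ≤ b m) {p : ℝ} (hp : 0 < p) {M : ℕ}
    (hball : ∑ m ∈ Finset.range M, (b m / (1 / ω (e m))) ^ p ≤ 1) :
    ellNorm (ENNReal.ofReal p)
      (fun m => (ω (e m) : ℂ) * if m < M then (b m : ℂ) else 0) ≤ 1 := by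
  rw [← ENNReal.ofReal_one, ellNorm_ofReal_le_iff hp zero_le_one]
  intro S
  rw [Real.one_rpow]
  refine le_trans ?_ hball
  have hterm : ∀ m, ‖(ω (e m) : ℂ) * if m < M then (b m : ℂ) else 0‖ ^ p =
      if m ∈ Finset.range M then (b m / (1 / ω (e m))) ^ p else 0 := by
    intro m
    rw [norm_weight_mul (fun m => hpos (e m))]
    simp only [Finset.mem_range]
    split_ifs
    · rw [Complex.norm_real, Real.norm_of_nonneg (hb0 m), div_div_eq_mul_div, div_one, mul_comm]
    · simp [hp.ne']
  simp only [hterm]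
  rw [← Finset.sum_filter]
  refine Finset.sum_le_sum_of_subset_of_nonneg (fun m hm => (Finset.mem_filter.1 hm).2)
    fun m _ _ => Real.rpow_nonneg (div_nonneg (hb0 m) (one_div_pos.2 (hpos _)).le) _

lemma sum_Ico_le_sum_sdiff {v : ℕ → ℝ} (hv : Antitone v) (hv0 : ∀ m, 0 ≤ v m) {T : Finset ℕ} {n : ℕ}
    (hT : T.card ≤ n) (M : ℕ) :
    ∑ m ∈ Finset.Ico n M, v m ≤ ∑ m ∈ Finset.range M \ T, v m := by
  rcases le_total M n with h | h
  · rw [Finset.Ico_eq_empty_of_le h, Finset.sum_empty]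
    exact Finset.sum_nonneg fun m _ => hv0 m
  · have h1 : ∑ m ∈ Finset.range M ∩ T, v m ≤ ∑ m ∈ Finset.range n, v m :=
      (sum_le_sum_range_card_of_antitone hv _).trans
        (Finset.sum_le_sum_of_subset_of_nonneg (Finset.range_mono
          ((Finset.card_le_card Finset.inter_subset_right).trans hT)) fun m _ _ => hv0 m)
    have h2 := Finset.sum_inter_add_sum_sdiff (Finset.range M) T v
    have h3 := Finset.sum_range_add_sum_Ico v h
    linarith

lemma ofReal_sum_Ico_le_termWidth (hpos : ∀ k, 0 < ω k) (e : ℕ ≃ (Fin d → ℤ)) {b : ℕ → ℝ}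
    (hb : Antitone b) (hb0 : ∀ m, 0 ≤ b m) {p q : ℝ} (hp : 0 < p) (hq : 0 < q) {M : ℕ}
    (hball : ∑ m ∈ Finset.range M, (b m / (1 / ω (e m))) ^ p ≤ 1) (n : ℕ) :
    ENNReal.ofReal ((∑ m ∈ Finset.Ico n M, b m ^ q) ^ (1 / q)) ≤
      termWidth ω (ENNReal.ofReal p) (ENNReal.ofReal q) n := by
  refine le_termWidth (by simpa using hp) e b M n (ellNorm_truncate_le_one hpos e hb0 hp hball)
    fun T g hT hg => ?_
  refine le_trans (ENNReal.ofReal_le_ofReal ?_)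
    (ofReal_sum_rpow_le_ellNorm hq g ((Finset.range M \ T).map e.toEmbedding))
  refine Real.rpow_le_rpow (Finset.sum_nonneg fun m _ => Real.rpow_nonneg (hb0 m) _) ?_
    (by positivity)
  refine (sum_Ico_le_sum_sdiff (fun i j hij => Real.rpow_le_rpow (hb0 j) (hb hij) hq.le)
    (fun m => Real.rpow_nonneg (hb0 m) _) hT M).trans (le_of_eq ?_)
  rw [Finset.sum_map]
  refine Finset.sum_congr rfl fun m hm => ?_
  rw [Finset.mem_sdiff, Finset.mem_range] at hm
  rw [Equiv.coe_toEmbedding, hg m hm.1 hm.2, Complex.norm_real, Real.norm_of_nonneg (hb0 m)]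

lemma ofReal_apply_le_ellNorm_top (e : ℕ ≃ (Fin d → ℤ)) {b : ℕ → ℝ} (hb : Antitone b)
    (hb0 : ∀ m, 0 ≤ b m) {n : ℕ} {T : Finset ℕ} {g : (Fin d → ℤ) → ℂ} (hT : T.card ≤ n)
    (hg : ∀ m < n + 1, m ∉ T → g (e m) = b m) : ENNReal.ofReal (b n) ≤ ellNorm ∞ g := by
  obtain ⟨m, hm, hmT⟩ : ∃ m ∈ Finset.range (n + 1), m ∉ T := by
    by_contra! hcon
    have := Finset.card_le_card hcon
    rw [Finset.card_range] at this
    omega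
  rw [Finset.mem_range] at hm
  refine le_trans (ENNReal.ofReal_le_ofReal ?_) (ofReal_norm_le_ellNorm_top g (e m))
  rw [hg m hm hmT, Complex.norm_real, Real.norm_of_nonneg (hb0 m)]
  exact hb (Nat.lt_succ_iff.1 hm)

lemma ofReal_apply_le_termWidth (hpos : ∀ k, 0 < ω k) (e : ℕ ≃ (Fin d → ℤ)) {b : ℕ → ℝ}
    (hb : Antitone b) (hb0 : ∀ m, 0 ≤ b m) {p : ℝ} (hp : 0 < p) {n : ℕ}
    (hball : ∑ m ∈ Finset.range (n + 1), (b m / (1 / ω (e m))) ^ p ≤ 1) :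
    ENNReal.ofReal (b n) ≤ termWidth ω (ENNReal.ofReal p) ∞ n :=
  le_termWidth (by simpa using hp) e b (n + 1) n (ellNorm_truncate_le_one hpos e hb0 hp hball)
    fun _ _ hT hg => ofReal_apply_le_ellNorm_top e hb hb0 hT hg

lemma ofReal_le_termWidth_top_top (hpos : ∀ k, 0 < ω k) {e : ℕ ≃ (Fin d → ℤ)}
    (hanti : Antitone fun m => 1 / ω (e m)) (n : ℕ) :
    ENNReal.ofReal (1 / ω (e n)) ≤ termWidth ω ∞ ∞ n := by
  refine le_termWidth ENNReal.top_ne_zero e (fun m => 1 / ω (e m)) (n + 1) n ?_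
    fun T g hT hg => ofReal_apply_le_ellNorm_top e hanti
      (fun m => (one_div_pos.2 (hpos (e m))).le) hT hg
  rw [← ENNReal.ofReal_one, ellNorm_top_le_iff zero_le_one]
  intro m
  rw [norm_weight_mul (fun m => hpos (e m))]
  split_ifs
  · rw [Complex.norm_real, Real.norm_of_nonneg (one_div_pos.2 (hpos _)).le,
      mul_one_div_cancel (hpos _).ne']
  · simp

end Width

/-! ### Power-logarithmic sequences and their sums -/

/-- The function `x ^ α (log x) ^ γ`. -/
noncomputable def powLog (α γ x : ℝ) : ℝ := x ^ α * Real.log x ^ γ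

lemma powLog_pos {x : ℝ} (hx : 1 < x) (α γ : ℝ) : 0 < powLog α γ x :=
  mul_pos (Real.rpow_pos_of_pos (by linarith) _) (Real.rpow_pos_of_pos (Real.log_pos hx) _)

lemma powLog_nonneg_nat (α γ : ℝ) (n : ℕ) : 0 ≤ powLog α γ n :=
  mul_nonneg (Real.rpow_nonneg n.cast_nonneg _) (Real.rpow_nonneg (Real.log_natCast_nonneg n) _)

lemma powLog_mul {x : ℝ} (hx : 1 < x) (α γ α' γ' : ℝ) :
    powLog α γ x * powLog α' γ' x = powLog (α + α') (γ + γ') x := by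
  unfold powLog
  rw [Real.rpow_add (by linarith), Real.rpow_add (Real.log_pos hx)]
  ring

lemma powLog_rpow {x : ℝ} (hx : 1 < x) (α γ c : ℝ) :
    powLog α γ x ^ c = powLog (α * c) (γ * c) x := by
  have h1 : 0 ≤ x := by linarith
  have h2 := (Real.log_pos hx).le
  unfold powLog
  rw [Real.mul_rpow (Real.rpow_nonneg h1 _) (Real.rpow_nonneg h2 _), Real.rpow_mul h1,
    Real.rpow_mul h2]

lemma eventually_one_lt_natCast : ∀ᶠ n : ℕ in atTop, (1 : ℝ) < n :=
  tendsto_natCast_atTop_atTop.eventually_gt_atTop 1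

/-- `powLog α γ` is regularly varying of index `α`. -/
lemma tendsto_powLog_div {ι : Type*} {F : Filter ι} {u x : ι → ℝ} (hx : Tendsto x F atTop) {t : ℝ}
    (ht : 0 < t) (hu : Tendsto (fun i => u i / x i) F (𝓝 t)) (α γ : ℝ) :
    Tendsto (fun i => powLog α γ (u i) / powLog α γ (x i)) F (𝓝 (t ^ α)) := by
  have hlogx : Tendsto (fun i => Real.log (x i)) F atTop := Real.tendsto_log_atTop.comp hx
  have h1 : Tendsto (fun i => 1 + Real.log (u i / x i) / Real.log (x i)) F (𝓝 (1 + 0)) :=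
    tendsto_const_nhds.add ((hu.log ht.ne').div_atTop hlogx)
  have h2 : Tendsto (fun i => (u i / x i) ^ α *
      (1 + Real.log (u i / x i) / Real.log (x i)) ^ γ) F (𝓝 (t ^ α * (1 + 0) ^ γ)) :=
    (hu.rpow_const (Or.inl ht.ne')).mul (h1.rpow_const (Or.inl (by norm_num)))
  rw [add_zero, Real.one_rpow, mul_one] at h2
  rw [add_zero] at h1
  refine h2.congr' ?_
  filter_upwards [hx.eventually_gt_atTop 1, hu.eventually (lt_mem_nhds ht),
    h1.eventually (lt_mem_nhds one_pos)] with i hxi hui hli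
  have hx0 : 0 < x i := by linarith
  have hl : 0 < Real.log (x i) := Real.log_pos hxi
  have hu0 : 0 < u i := (div_pos_iff_of_pos_right hx0).1 hui
  have e1 : 1 + Real.log (u i / x i) / Real.log (x i) = Real.log (u i) / Real.log (x i) := by
    rw [Real.log_div hu0.ne' hx0.ne']; field_simp; ring
  rw [e1] at hli ⊢
  have hlu : 0 < Real.log (u i) := (div_pos_iff_of_pos_right hl).1 hli
  unfold powLog
  rw [Real.div_rpow hu0.le hx0.le, Real.div_rpow hlu.le hl.le, div_mul_div_comm]

lemma tendsto_powLog_zero {α : ℝ} (hα : α < 0) (γ : ℝ) :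
    Tendsto (fun n : ℕ => powLog α γ n) atTop (𝓝 0) := by
  have h := (isLittleO_log_rpow_rpow_atTop γ (neg_pos.2 hα)).tendsto_div_nhds_zero
  refine (h.comp tendsto_natCast_atTop_atTop).congr fun n => ?_
  rw [Function.comp_apply, Real.rpow_neg n.cast_nonneg, div_inv_eq_mul, mul_comm, powLog]

lemma tendsto_powLog_atTop {α : ℝ} (hα : 0 < α) (γ : ℝ) :
    Tendsto (fun n : ℕ => powLog α γ n) atTop atTop := by
  have h : Tendsto (fun n : ℕ => powLog (-α) (-γ) n) atTop (𝓝[>] 0) :=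
    tendsto_nhdsWithin_iff.2 ⟨tendsto_powLog_zero (neg_lt_zero.2 hα) _, by
      filter_upwards [eventually_one_lt_natCast] with n hn using powLog_pos hn _ _⟩
  refine h.inv_tendsto_nhdsGT_zero.congr' ?_
  filter_upwards [eventually_one_lt_natCast] with n hn
  rw [Pi.inv_apply, ← Real.rpow_neg_one, powLog_rpow hn]
  simp

lemma hasDerivAt_powLog (α γ : ℝ) {x : ℝ} (hx : 1 < x) :
    HasDerivAt (powLog (α + 1) γ) (powLog α γ x * (α + 1 + γ / Real.log x)) x := by
  have hx0 : 0 < x := by linarith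
  have hl := Real.log_pos hx
  have h := (Real.hasDerivAt_rpow_const (p := α + 1) (Or.inl hx0.ne')).mul
    ((Real.hasDerivAt_log hx0.ne').rpow_const (p := γ) (Or.inl hl.ne'))
  refine h.congr_deriv ?_
  unfold powLog
  rw [add_sub_cancel_right, Real.rpow_add_one hx0.ne', Real.rpow_sub_one hl.ne']
  field_simp

lemma tendsto_powLog_sub_div (α γ : ℝ) :
    Tendsto (fun n : ℕ => (powLog (α + 1) γ (n + 1 : ℕ) - powLog (α + 1) γ n) / powLog α γ n) atTop
      (𝓝 (α + 1)) := by
  have hex : ∀ n : ℕ, ∃ ξ : ℝ, (n : ℝ) ≤ ξ ∧ ξ ≤ n + 1 ∧ ((1 : ℝ) < n →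
      powLog (α + 1) γ (n + 1 : ℕ) - powLog (α + 1) γ n =
        powLog α γ ξ * (α + 1 + γ / Real.log ξ)) := by
    intro n
    by_cases hn : (1 : ℝ) < n
    · have hcont : ContinuousOn (powLog (α + 1) γ) (Set.Icc (n : ℝ) (n + 1 : ℕ)) := fun x hx =>
        (hasDerivAt_powLog α γ (hn.trans_le hx.1)).continuousAt.continuousWithinAt
      obtain ⟨ξ, hξ, h⟩ := exists_hasDerivAt_eq_slope (powLog (α + 1) γ) _
        (by push_cast; linarith) hcont fun x hx => hasDerivAt_powLog α γ (hn.trans hx.1)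
      push_cast at hξ
      refine ⟨ξ, hξ.1.le, hξ.2.le, fun _ => ?_⟩
      rw [h]; push_cast; simp
    · exact ⟨n, le_rfl, by linarith, fun h => absurd h hn⟩
  choose ξ h1 h2 h3 using hex
  have hnat : Tendsto (fun n : ℕ => (n : ℝ)) atTop atTop := tendsto_natCast_atTop_atTop
  have hξ : Tendsto ξ atTop atTop := tendsto_atTop_mono h1 hnat
  have hratio : Tendsto (fun n : ℕ => ξ n / n) atTop (𝓝 1) := by
    have hup : Tendsto (fun n : ℕ => 1 + 1 / (n : ℝ)) atTop (𝓝 (1 + 0)) :=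
      tendsto_const_nhds.add tendsto_one_div_atTop_nhds_zero_nat
    rw [add_zero] at hup
    refine tendsto_of_tendsto_of_tendsto_of_le_of_le' tendsto_const_nhds hup ?_ ?_
    · filter_upwards [eventually_one_lt_natCast] with n hn
      rw [one_le_div (by linarith)]; exact h1 n
    · filter_upwards [eventually_one_lt_natCast] with n hn
      have hn0 : (0 : ℝ) < n := by linarith
      rw [div_le_iff₀ hn0, add_mul, one_div_mul_cancel hn0.ne', one_mul]
      exact h2 n
  have hlim := (tendsto_powLog_div hnat one_pos hratio α γ).mul
    ((tendsto_const_nhds (x := α + 1)).add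
      ((tendsto_const_nhds (x := γ)).div_atTop (Real.tendsto_log_atTop.comp hξ)))
  rw [Real.one_rpow, one_mul, add_zero] at hlim
  refine hlim.congr' ?_
  filter_upwards [eventually_one_lt_natCast] with n hn
  rw [h3 n hn, Function.comp_apply]
  ring

/-- The Stolz–Cesàro theorem. -/
lemma tendsto_sum_range_div {u G : ℕ → ℝ} {c : ℝ} (hG : Tendsto G atTop atTop)
    (hD : ∀ᶠ k in atTop, 0 < G (k + 1) - G k)
    (hu : Tendsto (fun k => u k / (G (k + 1) - G k)) atTop (𝓝 c)) :
    Tendsto (fun N => (∑ k ∈ Finset.range N, u k) / G N) atTop (𝓝 c) := by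
  set g : ℕ → ℝ := fun k => max (G (k + 1) - G k) 0 with hg
  have hge : ∀ᶠ k in atTop, g k = G (k + 1) - G k := hD.mono fun k hk => max_eq_left hk.le
  have hsumg : Tendsto (fun N => ∑ k ∈ Finset.range N, g k) atTop atTop := by
    refine tendsto_atTop_mono (fun N => ?_) (tendsto_atTop_add_const_right _ (-(G 0)) hG)
    rw [← sub_eq_add_neg, ← Finset.sum_range_sub G]
    exact Finset.sum_le_sum fun k _ => le_max_left _ _
  have ho : (fun k => u k - c * g k) =o[atTop] g := by
    rw [Asymptotics.isLittleO_iff_tendsto']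
    · have : Tendsto (fun k => u k / (G (k + 1) - G k) - c) atTop (𝓝 (c - c)) :=
        hu.sub tendsto_const_nhds
      rw [sub_self] at this
      refine this.congr' ?_
      filter_upwards [hge, hD] with k hk hk'
      rw [hk]; field_simp
    · filter_upwards [hge, hD] with k hk hk' h0
      rw [hk] at h0; exact absurd h0 hk'.ne'
  have hs := (ho.sum_range (fun k => le_max_right _ _) hsumg).tendsto_div_nhds_zero
  -- The sums of `g` differ from `G` by an eventually constant amount.
  obtain ⟨N₀, hN₀⟩ := eventually_atTop.1 hge
  have hconst : ∀ N ≥ N₀, ∑ k ∈ Finset.range N, g k =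
      G N + (∑ k ∈ Finset.range N₀, g k - G N₀) := by
    intro N hN
    rw [← Finset.sum_range_add_sum_Ico _ hN,
      Finset.sum_congr rfl fun k hk => hN₀ k (Finset.mem_Ico.1 hk).1, Finset.sum_Ico_sub G hN]
    ring
  have hratio : Tendsto (fun N => (∑ k ∈ Finset.range N, g k) / G N) atTop (𝓝 1) := by
    have : Tendsto (fun N => 1 + (∑ k ∈ Finset.range N₀, g k - G N₀) / G N) atTop (𝓝 (1 + 0)) :=
      tendsto_const_nhds.add (tendsto_const_nhds.div_atTop hG)
    rw [add_zero] at this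
    refine this.congr' ?_
    filter_upwards [eventually_ge_atTop N₀, hG.eventually_gt_atTop 0] with N hN hGN
    rw [hconst N hN, add_div, div_self hGN.ne']
  have hfin := (hs.add_const c).mul hratio
  rw [zero_add, mul_one] at hfin
  refine hfin.congr' ?_
  filter_upwards [hsumg.eventually_gt_atTop 0, hG.eventually_gt_atTop 0] with N hgN hGN
  rw [Finset.sum_sub_distrib, ← Finset.mul_sum]
  field_simp
  ring

/-- The Stolz–Cesàro theorem for tails of convergent series. -/
lemma tendsto_tsum_div {u G : ℕ → ℝ} {c : ℝ} (hG : Tendsto G atTop (𝓝 0))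
    (hD : ∀ᶠ k in atTop, 0 < G k - G (k + 1))
    (hu : Tendsto (fun k => u k / (G k - G (k + 1))) atTop (𝓝 c)) :
    Summable u ∧ Tendsto (fun N => (∑' k, u (k + N)) / G N) atTop (𝓝 c) := by
  obtain ⟨N₀, hN₀⟩ := eventually_atTop.1 hD
  have hsum : ∀ N ≥ N₀, HasSum (fun k => G (k + N) - G (k + N + 1)) (G N) := by
    intro N hN
    rw [hasSum_iff_tendsto_nat_of_nonneg fun k => (hN₀ _ (by omega)).le]
    have h1 : ∀ m, ∑ k ∈ Finset.range m, (G (k + N) - G (k + N + 1)) = G N - G (m + N) :=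
        fun m => by
      have := Finset.sum_range_sub' (fun k => G (k + N)) m
      simp only [zero_add] at this
      rw [← this]
      exact Finset.sum_congr rfl fun k _ => by rw [add_right_comm]
    simp only [h1]
    simpa using tendsto_const_nhds.sub ((tendsto_add_atTop_iff_nat N).2 hG)
  have hbd : ∀ ε > 0, ∀ᶠ k in atTop, |u k - c * (G k - G (k + 1))| ≤ ε * (G k - G (k + 1)) := by
    intro ε hε
    filter_upwards [hu.eventually (Metric.closedBall_mem_nhds c hε), hD] with k hk hDk
    rw [Real.dist_eq] at hk
    have : u k - c * (G k - G (k + 1)) = (u k / (G k - G (k + 1)) - c) * (G k - G (k + 1)) := by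
      field_simp
    rw [this, abs_mul, abs_of_pos hDk]
    gcongr
  have hsu : Summable u := by
    obtain ⟨N₁, hN₁⟩ := eventually_atTop.1 (hbd 1 one_pos)
    have hS := hsum (max N₀ N₁) (le_max_left _ _)
    rw [← summable_nat_add_iff (max N₀ N₁)]
    have h1 : Summable fun k => u (k + max N₀ N₁) -
        c * (G (k + max N₀ N₁) - G (k + max N₀ N₁ + 1)) :=
      Summable.of_norm_bounded (hS.summable.mul_left 1) fun k =>
        hN₁ _ ((le_max_right _ _).trans (Nat.le_add_left _ _))
    simpa using h1.add (hS.summable.mul_left c)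
  refine ⟨hsu, ?_⟩
  have hGpos : ∀ N ≥ N₀, 0 < G N := fun N hN =>
    (hsum N hN).summable.tsum_pos (fun k => (hN₀ _ (by omega)).le) 0
      (by simpa using hN₀ N hN) |>.trans_eq (hsum N hN).tsum_eq
  rw [Metric.tendsto_atTop]
  intro ε hε
  obtain ⟨N₁, hN₁⟩ := eventually_atTop.1 (hbd (ε / 2) (half_pos hε))
  refine ⟨max N₀ N₁, fun N hN => ?_⟩
  have hS := hsum N ((le_max_left _ _).trans hN)
  have hG0 := hGpos N ((le_max_left _ _).trans hN)
  have h1 : HasSum (fun k => u (k + N) - c * (G (k + N) - G (k + N + 1)))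
      (∑' k, u (k + N) - c * G N) :=
    ((summable_nat_add_iff N).2 hsu).hasSum.sub (hS.mul_left c)
  have h2 : |∑' k, u (k + N) - c * G N| ≤ ε / 2 * G N := by
    rw [← h1.tsum_eq, ← (hS.mul_left (ε / 2)).tsum_eq]
    exact tsum_of_norm_bounded (f := fun k => u (k + N) - c * (G (k + N) - G (k + N + 1)))
      (hS.mul_left (ε / 2)).summable.hasSum fun k =>
        hN₁ _ ((le_max_right _ _).trans (hN.trans (Nat.le_add_left _ _)))
  rw [Real.dist_eq, show (∑' k, u (k + N)) / G N - c = (∑' k, u (k + N) - c * G N) / G N by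
    field_simp, abs_div, abs_of_pos hG0, div_lt_iff₀ hG0]
  nlinarith

lemma tendsto_sum_range_div_powLog {u : ℕ → ℝ} {α γ c : ℝ} (hα : -1 < α)
    (hu : Tendsto (fun k => u k / powLog α γ k) atTop (𝓝 c)) :
    Tendsto (fun N : ℕ => (∑ k ∈ Finset.range N, u k) / powLog (α + 1) γ N) atTop
      (𝓝 (c / (α + 1))) := by
  have hα' : 0 < α + 1 := by linarith
  have hd := tendsto_powLog_sub_div α γ
  refine tendsto_sum_range_div (G := fun N : ℕ => powLog (α + 1) γ N)
    (tendsto_powLog_atTop hα' γ) ?_ ?_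
  · filter_upwards [hd.eventually (lt_mem_nhds hα'), eventually_one_lt_natCast] with n hn h1
    exact (div_pos_iff_of_pos_right (powLog_pos h1 _ _)).1 hn
  · refine (hu.div hd hα'.ne').congr' ?_
    filter_upwards [eventually_one_lt_natCast] with n h1
    exact div_div_div_cancel_right₀ (powLog_pos h1 _ _).ne' _ _

lemma tendsto_tsum_div_powLog {u : ℕ → ℝ} {α γ c : ℝ} (hα : α < -1)
    (hu : Tendsto (fun k => u k / powLog α γ k) atTop (𝓝 c)) :
    Summable u ∧ Tendsto (fun N : ℕ => (∑' k, u (k + N)) / powLog (α + 1) γ N) atTop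
      (𝓝 (c / (-(α + 1)))) := by
  have hα' : 0 < -(α + 1) := by linarith
  have hd := (tendsto_powLog_sub_div α γ).neg
  refine tendsto_tsum_div (G := fun N : ℕ => powLog (α + 1) γ N)
    (tendsto_powLog_zero (by linarith) γ) ?_ ?_
  · filter_upwards [hd.eventually (lt_mem_nhds hα'), eventually_one_lt_natCast] with n hn h1
    rw [← neg_div, neg_sub] at hn
    exact (div_pos_iff_of_pos_right (powLog_pos h1 _ _)).1 hn
  · refine (hu.div hd hα'.ne').congr' ?_
    filter_upwards [eventually_one_lt_natCast] with n h1
    rw [Pi.div_apply, ← neg_div, neg_sub]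
    exact div_div_div_cancel_right₀ (powLog_pos h1 _ _).ne' _ _

/-! ### Asymptotics of the extremal problem -/

/-- The maximum of `(x - 1) ^ a / x ^ b` over `x ≥ 1`, for `0 ≤ a < b`. -/
noncomputable def maxRatio (a b : ℝ) : ℝ := a ^ a * (b - a) ^ (b - a) / b ^ b

lemma maxRatio_pos {a b : ℝ} (ha : 0 ≤ a) (hab : a < b) : 0 < maxRatio a b := by
  have hb : 0 < b := ha.trans_lt hab
  have h1 : 0 < a ^ a := by
    rcases ha.eq_or_lt with rfl | h
    · simp
    · positivity
  have h2 : 0 < b - a := by linarith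
  unfold maxRatio
  positivity

lemma sub_one_rpow_le_maxRatio_mul {a b x : ℝ} (ha : 0 ≤ a) (hab : a < b) (hx : 1 ≤ x) :
    (x - 1) ^ a ≤ maxRatio a b * x ^ b := by
  have hb : 0 < b := ha.trans_lt hab
  have hx0 : 0 < x := by linarith
  rcases ha.eq_or_lt with rfl | ha
  · have : maxRatio 0 b = 1 := by
      unfold maxRatio
      rw [Real.rpow_zero, one_mul, sub_zero, div_self (Real.rpow_pos_of_pos hb _).ne']
    rw [this, Real.rpow_zero, one_mul]
    exact Real.one_le_rpow hx hb.le
  · have hba : 0 < b - a := by linarith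
    have hx1 : 0 ≤ x - 1 := by linarith
    have h := Real.geom_mean_le_arith_mean2_weighted (w₁ := a / b) (w₂ := (b - a) / b)
      (p₁ := (x - 1) / a) (p₂ := 1 / (b - a)) (by positivity) (by positivity) (by positivity)
      (by positivity) (by field_simp; ring)
    have e1 : a / b * ((x - 1) / a) + (b - a) / b * (1 / (b - a)) = x / b := by
      field_simp; ring
    rw [e1] at h
    have h2 := Real.rpow_le_rpow (by positivity) h hb.le
    rw [Real.mul_rpow (by positivity) (by positivity), ← Real.rpow_mul (by positivity),
      ← Real.rpow_mul (by positivity), div_mul_cancel₀ _ hb.ne', div_mul_cancel₀ _ hb.ne',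
      Real.div_rpow hx1 ha.le, Real.div_rpow zero_le_one hba.le, Real.one_rpow,
      Real.div_rpow hx0.le hb.le, div_mul_div_comm, mul_one, div_le_div_iff₀ (by positivity)
      (by positivity)] at h2
    unfold maxRatio
    rw [div_mul_eq_mul_div, le_div_iff₀ (by positivity)]
    linarith

/-- The maximum `maxRatio a b` is attained at `x = b / (b - a)`. -/
lemma maxRatio_eq {a b : ℝ} (ha : 0 ≤ a) (hab : a < b) :
    maxRatio a b = (b / (b - a) - 1) ^ a * (b / (b - a)) ^ (-b) := by
  have hb : 0 < b := ha.trans_lt hab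
  have hba : 0 < b - a := by linarith
  have e1 : b / (b - a) - 1 = a / (b - a) := by field_simp; ring
  rw [e1, Real.div_rpow ha hba.le, Real.rpow_neg (by positivity), Real.div_rpow hb.le hba.le]
  unfold maxRatio
  rw [Real.rpow_sub hba]
  field_simp

/-- If `V_N ∼ v N ^ (-b) (log N) ^ β`, the supremum over `N > n` of `(N - n) ^ a V_N` is at most
asymptotically `maxRatio a b * v * n ^ (a - b) (log n) ^ β`. -/
lemma eventually_forall_mul_le {V : ℕ → ℝ} {a b β v v' : ℝ} (ha : 0 ≤ a) (hab : a < b) (hβ : 0 ≤ β)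
    (hv : 0 < v) (hV : Tendsto (fun N : ℕ => V N / powLog (-b) β N) atTop (𝓝 v))
    (hv' : maxRatio a b * v < v') :
    ∀ᶠ n : ℕ in atTop, ∀ N, n < N → ((N - n : ℕ) : ℝ) ^ a * V N ≤ v' * powLog (a - b) β n := by
  -- The factor `(log N / log n) ^ β` costs an arbitrarily small power of `N / n`.
  obtain ⟨δ, hδ, hδb, hδv⟩ : ∃ δ > 0, a < b - δ * β ∧
      maxRatio a (b - δ * β) * (v * (1 + δ)) < v' := by
    have hb : 0 < b := ha.trans_lt hab
    have hba : b - a ≠ 0 := by linarith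
    have hcont : ContinuousAt (fun δ : ℝ => maxRatio a (b - δ * β) * (v * (1 + δ))) 0 := by
      unfold maxRatio
      have h1 : ContinuousAt (fun δ : ℝ => b - δ * β) 0 := by fun_prop
      have h2 : ContinuousAt (fun δ : ℝ => b - δ * β - a) 0 := by fun_prop
      refine ContinuousAt.mul (ContinuousAt.div (continuousAt_const.mul
        (h2.rpow h2 (Or.inl ?_))) (h1.rpow h1 (Or.inl ?_)) ?_) (by fun_prop)
      · simpa using hba
      · simpa using hb.ne'
      · simpa using (Real.rpow_pos_of_pos hb b).ne'
    have hcont2 : ContinuousAt (fun δ : ℝ => b - δ * β) 0 := by fun_prop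
    have e1 := hcont.tendsto.eventually_lt_const (u := v') (by simpa using hv')
    have e2 := hcont2.tendsto.eventually_const_lt (u := a) (by simpa using hab)
    obtain ⟨δ, ⟨h1, h2⟩, h3⟩ := (((e1.and e2).filter_mono
      (nhdsWithin_le_nhds (s := Set.Ioi 0))).and self_mem_nhdsWithin).exists
    exact ⟨δ, h3, h2, h1⟩
  have hVle : ∀ᶠ N : ℕ in atTop, V N ≤ v * (1 + δ) * powLog (-b) β N := by
    filter_upwards [hV.eventually (gt_mem_nhds (show v < v * (1 + δ) by nlinarith)),
      eventually_one_lt_natCast] with N hN h1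
    exact ((div_lt_iff₀ (powLog_pos h1 _ _)).1 hN).le
  obtain ⟨N₀, hN₀⟩ := eventually_atTop.1 hVle
  have hlog : Tendsto (fun n : ℕ => Real.log n) atTop atTop :=
    Real.tendsto_log_atTop.comp tendsto_natCast_atTop_atTop
  filter_upwards [eventually_ge_atTop N₀, eventually_one_lt_natCast,
    hlog.eventually_ge_atTop (1 / δ)] with n hn h1n hlogn N hN
  have hn0 : (0 : ℝ) < n := by linarith
  set x : ℝ := N / n with hx
  have hx1 : 1 ≤ x := by
    rw [hx, one_le_div hn0]; exact_mod_cast hN.le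
  have hx0 : 0 < x := by linarith
  have hNx : (N : ℝ) = n * x := by rw [hx]; field_simp
  have hln : 0 < Real.log n := Real.log_pos h1n
  have hlogN : Real.log N ≤ Real.log n * x ^ δ := by
    rw [hNx, Real.log_mul hn0.ne' hx0.ne']
    have h2 : Real.log x ≤ Real.log n * (δ * Real.log x) := by
      have : 1 ≤ Real.log n * δ := by rwa [div_le_iff₀ hδ] at hlogn
      nlinarith [Real.log_nonneg hx1]
    have h3 : 1 + δ * Real.log x ≤ x ^ δ := by
      rw [Real.rpow_def_of_pos hx0, add_comm, mul_comm (Real.log x)]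
      exact Real.add_one_le_exp _
    nlinarith
  have hsub : ((N - n : ℕ) : ℝ) = n * (x - 1) := by
    rw [Nat.cast_sub hN.le, hNx]; ring
  have hlogN' : Real.log N ^ β ≤ Real.log n ^ β * x ^ (δ * β) := by
    rw [Real.rpow_mul hx0.le, ← Real.mul_rpow hln.le (by positivity)]
    exact Real.rpow_le_rpow (Real.log_natCast_nonneg N) hlogN hβ
  have hx1' : 0 ≤ x - 1 := by linarith
  calc ((N - n : ℕ) : ℝ) ^ a * V N
      ≤ ((N - n : ℕ) : ℝ) ^ a * (v * (1 + δ) * powLog (-b) β N) := by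
        gcongr
        exact hN₀ N (hn.trans hN.le)
    _ ≤ ((N - n : ℕ) : ℝ) ^ a *
        (v * (1 + δ) * ((N : ℝ) ^ (-b) * (Real.log n ^ β * x ^ (δ * β)))) := by
        unfold powLog
        gcongr
    _ = v * (1 + δ) * powLog (a - b) β n * ((x - 1) ^ a * x ^ (-(b - δ * β))) := by
        rw [hsub, hNx, Real.mul_rpow hn0.le hx1', Real.mul_rpow hn0.le hx0.le, powLog,
          show a - b = a + -b by ring, Real.rpow_add hn0,
          show -(b - δ * β) = -b + δ * β by ring, Real.rpow_add hx0]
        ring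
    _ ≤ v * (1 + δ) * powLog (a - b) β n * maxRatio a (b - δ * β) := by
        have := powLog_nonneg_nat (a - b) β n
        gcongr
        rw [Real.rpow_neg hx0.le, ← div_eq_mul_inv, div_le_iff₀ (by positivity)]
        exact sub_one_rpow_le_maxRatio_mul ha hδb hx1
    _ = maxRatio a (b - δ * β) * (v * (1 + δ)) * powLog (a - b) β n := by ring
    _ ≤ v' * powLog (a - b) β n :=
        mul_le_mul_of_nonneg_right hδv.le (powLog_nonneg_nat _ _ n)

/-- The integer `⌊t n⌋ + 1`, which exceeds `n` when `t ≥ 1`. -/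
noncomputable def scaledIndex (t : ℝ) (n : ℕ) : ℕ := ⌊t * n⌋₊ + 1

lemma lt_scaledIndex {t : ℝ} (ht : 1 ≤ t) (n : ℕ) : n < scaledIndex t n := by
  refine Nat.lt_succ_of_le (Nat.le_floor ?_)
  nlinarith [n.cast_nonneg (α := ℝ)]

lemma tendsto_scaledIndex_div {t : ℝ} (ht : 1 ≤ t) :
    Tendsto (fun n : ℕ => (scaledIndex t n : ℝ) / n) atTop (𝓝 t) := by
  have h1 := (tendsto_nat_floor_mul_div_atTop (R := ℝ) (a := t) (by linarith)).comp
    (tendsto_natCast_atTop_atTop (R := ℝ))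
  have h2 := h1.add (tendsto_one_div_atTop_nhds_zero_nat (𝕜 := ℝ))
  rw [add_zero] at h2
  refine h2.congr fun n => ?_
  simp [scaledIndex, add_div]

lemma tendsto_scaledIndex_sub_div {t : ℝ} (ht : 1 ≤ t) :
    Tendsto (fun n : ℕ => ((scaledIndex t n - n : ℕ) : ℝ) / n) atTop (𝓝 (t - 1)) := by
  refine ((tendsto_scaledIndex_div ht).sub_const 1).congr' ?_
  filter_upwards [eventually_one_lt_natCast] with n hn
  rw [Nat.cast_sub (lt_scaledIndex ht n).le]
  have : (n : ℝ) ≠ 0 := by linarith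
  field_simp

lemma tendsto_scaledIndex {t : ℝ} (ht : 1 ≤ t) : Tendsto (scaledIndex t) atTop atTop :=
  tendsto_atTop_mono (fun n => (lt_scaledIndex ht n).le) tendsto_id

/-- An asymptotic equivalence with `powLog α γ` passes to the subsequence `scaledIndex t`. -/
lemma tendsto_comp_scaledIndex_div {V : ℕ → ℝ} {α γ v t : ℝ} (ht : 1 ≤ t)
    (hV : Tendsto (fun N : ℕ => V N / powLog α γ N) atTop (𝓝 v)) :
    Tendsto (fun n : ℕ => V (scaledIndex t n) / powLog α γ n) atTop (𝓝 (v * t ^ α)) := by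
  have h := (hV.comp (tendsto_scaledIndex ht)).mul
    (tendsto_powLog_div tendsto_natCast_atTop_atTop (by linarith) (tendsto_scaledIndex_div ht) α γ)
  refine h.congr' ?_
  filter_upwards [eventually_one_lt_natCast] with n hn
  have : (1 : ℝ) < scaledIndex t n := hn.trans (by exact_mod_cast lt_scaledIndex ht n)
  exact div_mul_div_cancel₀ (powLog_pos this _ _).ne'

/-- The lower counterpart of `eventually_forall_mul_le`: the supremum is asymptotically attained at
`N = scaledIndex (b / (b - a)) n`. -/
lemma tendsto_scaledIndex_mul_div {V : ℕ → ℝ} {a b β v : ℝ} (ha : 0 ≤ a) (hab : a < b)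
    (hV : Tendsto (fun N : ℕ => V N / powLog (-b) β N) atTop (𝓝 v)) :
    Tendsto (fun n : ℕ => ((scaledIndex (b / (b - a)) n - n : ℕ) : ℝ) ^ a *
      V (scaledIndex (b / (b - a)) n) / powLog (a - b) β n) atTop (𝓝 (maxRatio a b * v)) := by
  have hba : 0 < b - a := by linarith
  have ht : 1 ≤ b / (b - a) := by rw [one_le_div hba]; linarith
  have h1 := ((tendsto_scaledIndex_sub_div ht).rpow_const (Or.inr ha)).mul
    (tendsto_comp_scaledIndex_div ht hV)
  rw [maxRatio_eq ha hab, mul_assoc, mul_comm _ v]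
  refine h1.congr' ?_
  filter_upwards [eventually_one_lt_natCast] with n hn
  have hn0 : (0 : ℝ) < n := by linarith
  have hl := (Real.rpow_pos_of_pos (Real.log_pos hn) β).ne'
  rw [Real.div_rpow (Nat.cast_nonneg _) hn0.le, powLog, powLog, show a - b = a + -b by ring,
    Real.rpow_add hn0]
  field_simp

lemma tendsto_rpow_div_powLog {l : ℕ → ℝ} (hl : ∀ k, 0 ≤ l k) {α β D : ℝ} (hD : 0 < D)
    (h : Tendsto (fun k : ℕ => l k / powLog α β k) atTop (𝓝 D)) (c : ℝ) :
    Tendsto (fun k : ℕ => l k ^ c / powLog (α * c) (β * c) k) atTop (𝓝 (D ^ c)) := by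
  refine (h.rpow_const (p := c) (Or.inl hD.ne')).congr' ?_
  filter_upwards [eventually_one_lt_natCast] with n hn
  rw [Real.div_rpow (hl n) (powLog_pos hn _ _).le, powLog_rpow hn]

lemma tendsto_invPowSum_div {l : ℕ → ℝ} (hl : ∀ k, 0 < l k) {s β D p : ℝ} (hs : 0 < s) (hp : 0 < p)
    (hD : 0 < D) (h : Tendsto (fun k : ℕ => l k / powLog (-s) β k) atTop (𝓝 D)) :
    Tendsto (fun N : ℕ => invPowSum l p N / powLog (s * p + 1) (-(β * p)) N) atTop
      (𝓝 (D ^ (-p) / (s * p + 1))) := by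
  have h1 := tendsto_rpow_div_powLog (fun k => (hl k).le) hD h (-p)
  rw [neg_mul_neg, mul_neg] at h1
  exact tendsto_sum_range_div_powLog (by nlinarith [mul_pos hs hp]) h1

lemma tendsto_invPowSum_rpow_div {l : ℕ → ℝ} (hl : ∀ k, 0 < l k) {s β D p : ℝ} (hs : 0 < s)
    (hp : 0 < p) (hD : 0 < D) (h : Tendsto (fun k : ℕ => l k / powLog (-s) β k) atTop (𝓝 D)) :
    Tendsto (fun N : ℕ => invPowSum l p N ^ (-(1 / p)) / powLog (-(s + 1 / p)) β N) atTop
      (𝓝 ((s * p + 1) ^ (1 / p) * D)) := by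
  have hsp : 0 < s * p + 1 := by positivity
  have h1 := tendsto_rpow_div_powLog (fun N => invPowSum_nonneg hl p N) (by positivity)
    (tendsto_invPowSum_div hl hs hp hD h) (-(1 / p))
  have e1 : (s * p + 1) * -(1 / p) = -(s + 1 / p) := by field_simp
  have e2 : -(β * p) * -(1 / p) = β := by field_simp
  have e3 : (D ^ (-p) / (s * p + 1)) ^ (-(1 / p)) = (s * p + 1) ^ (1 / p) * D := by
    rw [Real.div_rpow (by positivity) hsp.le, ← Real.rpow_mul hD.le, Real.rpow_neg hsp.le,
      show -p * -(1 / p) = 1 by field_simp, Real.rpow_one, div_inv_eq_mul, mul_comm]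
  rwa [e1, e2, e3] at h1

/-! ### Limits of the widths for `p ≤ q` -/

lemma exists_equiv_antitone {d : ℕ} (hd : 1 ≤ d) {ω : (Fin d → ℤ) → ℝ} (hpos : ∀ k, 0 < ω k)
    (hω : Tendsto ω cofinite atTop) :
    ∃ e : ℕ ≃ (Fin d → ℤ), (Antitone fun m => 1 / ω (e m)) ∧
      ∀ n, decreasingRearrangement (fun k => 1 / ω k) (n + 1) = 1 / ω (e n) := by
  have : Nonempty (Fin d) := ⟨⟨0, hd⟩⟩
  have h0 : ∀ k, 0 ≤ 1 / ω k := fun k => (one_div_pos.2 (hpos k)).le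
  obtain ⟨e, he, hanti, hr⟩ := exists_antitone_enumeration (a := fun k => 1 / ω k) h0 (by
    simpa only [one_div, Function.comp_def] using tendsto_inv_atTop_zero.comp hω)
  refine ⟨Equiv.ofBijective e ⟨he, fun k => ?_⟩, hanti,
    decreasingRearrangement_succ h0 he hanti hr⟩
  by_contra hk
  exact (one_div_pos.2 (hpos k)).ne' (hr k hk)

lemma tendsto_div_powLog_of_succ {r l : ℕ → ℝ} {s β C : ℝ} (hrl : ∀ n, r (n + 1) = l n)
    (h : Tendsto (fun n : ℕ => r n / powLog (-s) β n) atTop (𝓝 C)) :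
    Tendsto (fun n : ℕ => l n / powLog (-s) β n) atTop (𝓝 C) := by
  have h1 := tendsto_comp_scaledIndex_div (t := 1) le_rfl h
  rw [Real.one_rpow, mul_one] at h1
  refine h1.congr fun n => ?_
  simp [scaledIndex, hrl]

/-- Adding a multiple of `powLog (-s) β` makes the limit positive, also when it is `0`. -/
lemma exists_majorant {L : ℕ → ℝ} (hL : ∀ k, 0 < L k) {s β C D : ℝ} (hCD : C < D)
    (h : Tendsto (fun n : ℕ => L n / powLog (-s) β n) atTop (𝓝 C)) :
    ∃ l : ℕ → ℝ, (∀ k, 0 < l k) ∧ (∀ k, L k ≤ l k) ∧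
      Tendsto (fun n : ℕ => l n / powLog (-s) β n) atTop (𝓝 D) := by
  have hnn : ∀ k : ℕ, 0 ≤ (D - C) * powLog (-s) β k := fun k =>
    mul_nonneg (by linarith) (powLog_nonneg_nat _ _ k)
  refine ⟨fun k => L k + (D - C) * powLog (-s) β k,
    fun k => add_pos_of_pos_of_nonneg (hL k) (hnn k), fun k => le_add_of_nonneg_right (hnn k), ?_⟩
  have h1 := h.add_const (D - C)
  rw [add_sub_cancel] at h1
  refine h1.congr' ?_
  filter_upwards [eventually_one_lt_natCast] with n hn
  have := (powLog_pos hn (-s) β).ne'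
  field_simp

lemma nonneg_of_tendsto_div_powLog {L : ℕ → ℝ} (hL : ∀ k, 0 ≤ L k) {α β C : ℝ}
    (h : Tendsto (fun n : ℕ => L n / powLog α β n) atTop (𝓝 C)) : 0 ≤ C :=
  ge_of_tendsto' h fun n => div_nonneg (hL n) (powLog_nonneg_nat _ _ n)

/-- The limit of the widths, from asymptotic bounds on both sides; the constant `C` may be `0`, in
which case the lower bound is trivial. -/
lemma tendsto_div_of_bounds {x : ℕ → ℝ} {α β K C : ℝ} (hx : ∀ n, 0 ≤ x n) (hK : 0 < K) (hC : 0 ≤ C)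
    (hu : ∀ D, C < D → ∀ R, K * D < R → ∀ᶠ n : ℕ in atTop, x n ≤ R * powLog α β n)
    (hl : 0 < C → ∃ y : ℕ → ℝ, (∀ n, y n ≤ x n) ∧
      Tendsto (fun n : ℕ => y n / powLog α β n) atTop (𝓝 (K * C))) :
    Tendsto (fun n : ℕ => x n / powLog α β n) atTop (𝓝 (K * C)) := by
  rw [tendsto_order]
  constructor
  · intro R hR
    rcases hC.eq_or_lt with rfl | hC
    · rw [mul_zero] at hR
      exact Eventually.of_forall fun n => hR.trans_le (div_nonneg (hx n) (powLog_nonneg_nat _ _ n))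
    · obtain ⟨y, hy, hlim⟩ := hl hC
      filter_upwards [hlim.eventually_const_lt hR] with n hn
      exact hn.trans_le (div_le_div_of_nonneg_right (hy n) (powLog_nonneg_nat _ _ n))
  · intro R hR
    have hCR : C < R / K := by rwa [lt_div_iff₀ hK, mul_comm]
    obtain ⟨D, hD, hDR⟩ := exists_between hCR
    rw [lt_div_iff₀ hK, mul_comm] at hDR
    obtain ⟨R', hR', hRR⟩ := exists_between hDR
    filter_upwards [hu D hD R' hR', eventually_one_lt_natCast] with n hn h1
    exact ((div_le_iff₀ (powLog_pos h1 _ _)).2 hn).trans_lt hRR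

lemma natCast_le_mul_invPowSum {L : ℕ → ℝ} (hL : ∀ k, 0 < L k) (hanti : Antitone L) {p : ℝ}
    (hp : 0 < p) (N : ℕ) : (N : ℝ) ≤ L 0 ^ p * invPowSum L p N := by
  rw [invPowSum, Finset.mul_sum]
  calc (N : ℝ) = ∑ _k ∈ Finset.range N, (1 : ℝ) := by simp
    _ ≤ _ := Finset.sum_le_sum fun k _ => by
      have := Real.rpow_pos_of_pos (hL k) p
      rw [Real.rpow_neg (hL k).le, ← div_eq_mul_inv, one_le_div this]
      exact Real.rpow_le_rpow (hL k).le (hanti k.zero_le) hp.le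

lemma invPowSum_rpow_mul_self {L : ℕ → ℝ} (hL : ∀ k, 0 < L k) {p : ℝ} (hp : 0 < p) {N : ℕ}
    (hN : 0 < N) :
    ∑ m ∈ Finset.range N, (invPowSum L p N ^ (-(1 / p)) / L m) ^ p = 1 := by
  have hW := invPowSum_pos hL p hN
  have h1 : ∀ m, (invPowSum L p N ^ (-(1 / p)) / L m) ^ p =
      (invPowSum L p N)⁻¹ * L m ^ (-p) := fun m => by
    rw [Real.div_rpow (by positivity) (hL m).le, ← Real.rpow_mul hW.le,
      show -(1 / p) * p = -1 by field_simp, Real.rpow_neg_one, Real.rpow_neg (hL m).le,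
      div_eq_mul_inv]
  simp only [h1]
  rw [← Finset.mul_sum]
  exact inv_mul_cancel₀ hW.ne'

section Limits

variable {d : ℕ} {ω : (Fin d → ℤ) → ℝ} {e : ℕ ≃ (Fin d → ℤ)}

lemma termWidth_ne_top_of_le (hd : 1 ≤ d) (hpos : ∀ k, 0 < ω k) (hω : Tendsto ω cofinite atTop)
    (hanti : Antitone fun m => 1 / ω (e m)) {p q : ℝ} (hp : 0 < p) (hpq : p ≤ q) (n : ℕ) :
    termWidth ω (ENNReal.ofReal p) (ENNReal.ofReal q) n ≠ ∞ := by
  have hL : ∀ m, 0 < 1 / ω (e m) := fun m => one_div_pos.2 (hpos _)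
  have hq := hp.trans_le hpq
  refine ne_top_of_le_ne_top ENNReal.ofReal_ne_top (termWidth_le_of_sum_Ico_le hd hpos hω hanti
    (fun m => le_rfl) hp hq (hL 0).le fun b hb hb0 hball M =>
      sum_Ico_rpow_le_of_le hL hb hb0 hp hpq (hL 0).le hball (fun N hN => ?_) M)
  have hN0 : 0 < N := Nat.zero_lt_of_lt hN
  have hW := invPowSum_pos hL p hN0
  have h1 := natCast_le_mul_invPowSum hL hanti hp N
  have h2 : ((N - n : ℕ) : ℝ) ^ (1 / q) ≤ (N : ℝ) ^ (1 / p) :=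
    (Real.rpow_le_rpow (Nat.cast_nonneg _) (by exact_mod_cast Nat.sub_le N n)
      (by positivity)).trans (Real.rpow_le_rpow_of_exponent_le (by exact_mod_cast hN0)
      (one_div_le_one_div_of_le hp hpq))
  have h3 : (N : ℝ) ^ (1 / p) ≤ 1 / ω (e 0) *
      invPowSum (fun m => 1 / ω (e m)) p N ^ (1 / p) := by
    have := Real.rpow_le_rpow (Nat.cast_nonneg _) h1 (one_div_nonneg.2 hp.le)
    rwa [Real.mul_rpow (Real.rpow_nonneg (hL 0).le _) hW.le, ← Real.rpow_mul (hL 0).le,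
      mul_one_div_cancel hp.ne', Real.rpow_one] at this
  rw [Real.rpow_neg hW.le, ← div_eq_mul_inv, div_le_iff₀ (by positivity)]
  exact h2.trans h3

theorem tendsto_termWidth_of_le (hd : 1 ≤ d) (hpos : ∀ k, 0 < ω k) (hω : Tendsto ω cofinite atTop)
    (hanti : Antitone fun m => 1 / ω (e m)) {s β C : ℝ} (hs : 0 < s) (hβ : 0 ≤ β)
    (hlim : Tendsto (fun n : ℕ => 1 / ω (e n) / powLog (-s) β n) atTop (𝓝 C)) {p q : ℝ}
    (hp : 0 < p) (hpq : p ≤ q) :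
    Tendsto (fun n : ℕ => (termWidth ω (ENNReal.ofReal p) (ENNReal.ofReal q) n).toReal /
      powLog (1 / q - (s + 1 / p)) β n) atTop
      (𝓝 (maxRatio (1 / q) (s + 1 / p) * (s * p + 1) ^ (1 / p) * C)) := by
  have hL : ∀ m, 0 < 1 / ω (e m) := fun m => one_div_pos.2 (hpos _)
  have hq := hp.trans_le hpq
  have hab : 1 / q < s + 1 / p := by linarith [one_div_le_one_div_of_le hp hpq]
  have ha : 0 ≤ 1 / q := by positivity
  have hκ := maxRatio_pos ha hab
  have hfin := termWidth_ne_top_of_le hd hpos hω hanti hp hpq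
  have hC := nonneg_of_tendsto_div_powLog (fun k => (hL k).le) hlim
  refine tendsto_div_of_bounds (fun n => ENNReal.toReal_nonneg) (by positivity) hC ?_ ?_
  · intro D hCD R hR
    obtain ⟨l, hl, hLl, hlD⟩ := exists_majorant hL hCD hlim
    have hD := hC.trans_lt hCD
    filter_upwards [eventually_forall_mul_le ha hab hβ (by positivity)
      (tendsto_invPowSum_rpow_div hl hs hp hD hlD) (by rwa [← mul_assoc])] with n hn
    have hR0 : 0 ≤ R * powLog (1 / q - (s + 1 / p)) β n :=
      mul_nonneg (le_trans (by positivity) hR.le) (powLog_nonneg_nat _ _ n)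
    exact ENNReal.toReal_le_of_le_ofReal hR0 (termWidth_le_of_sum_Ico_le hd hpos hω hanti hLl hp hq
      hR0 fun b hb hb0 hball M => sum_Ico_rpow_le_of_le hl hb hb0 hp hpq hR0 hball hn M)
  · intro hC
    refine ⟨_, fun n => ?_, by
      rw [mul_assoc]
      exact tendsto_scaledIndex_mul_div ha hab (tendsto_invPowSum_rpow_div hL hs hp hC hlim)⟩
    set N := scaledIndex ((s + 1 / p) / (s + 1 / p - 1 / q)) n with hN
    have hnN : n < N := lt_scaledIndex (by rw [one_le_div (by linarith)]; linarith) n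
    have hW := invPowSum_pos hL p (Nat.zero_lt_of_lt hnN)
    have h := ofReal_sum_Ico_le_termWidth hpos e
      (b := fun _ => invPowSum (fun m => 1 / ω (e m)) p N ^ (-(1 / p))) antitone_const
      (fun _ => by positivity) hp hq
      (invPowSum_rpow_mul_self hL hp (Nat.zero_lt_of_lt hnN)).le n
    rw [ENNReal.ofReal_le_iff_le_toReal (hfin n)] at h
    rwa [Finset.sum_const, Nat.card_Ico, nsmul_eq_mul, Real.mul_rpow (Nat.cast_nonneg _)
      (by positivity), ← Real.rpow_mul (by positivity) q, mul_one_div_cancel hq.ne',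
      Real.rpow_one] at h

lemma termWidth_top_ne_top (hd : 1 ≤ d) (hpos : ∀ k, 0 < ω k) (hω : Tendsto ω cofinite atTop)
    (hanti : Antitone fun m => 1 / ω (e m)) {p : ℝ} (hp : 0 < p) (n : ℕ) :
    termWidth ω (ENNReal.ofReal p) ∞ n ≠ ∞ := by
  have hL : ∀ m, 0 < 1 / ω (e m) := fun m => one_div_pos.2 (hpos _)
  exact ne_top_of_le_ne_top ENNReal.ofReal_ne_top (termWidth_top_le_of_apply_le hd hpos hω hanti
    (fun m => le_rfl) hp (Real.rpow_nonneg (invPowSum_nonneg hL p (n + 1)) _)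
    fun b hb hb0 hball => apply_le_of_sum_rpow_le hL hb hb0 hp hball le_rfl)

theorem tendsto_termWidth_top (hd : 1 ≤ d) (hpos : ∀ k, 0 < ω k) (hω : Tendsto ω cofinite atTop)
    (hanti : Antitone fun m => 1 / ω (e m)) {s β C : ℝ} (hs : 0 < s)
    (hlim : Tendsto (fun n : ℕ => 1 / ω (e n) / powLog (-s) β n) atTop (𝓝 C)) {p : ℝ}
    (hp : 0 < p) :
    Tendsto (fun n : ℕ => (termWidth ω (ENNReal.ofReal p) ∞ n).toReal /
      powLog (-(s + 1 / p)) β n) atTop (𝓝 ((s * p + 1) ^ (1 / p) * C)) := by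
  have hL : ∀ m, 0 < 1 / ω (e m) := fun m => one_div_pos.2 (hpos _)
  have hfin := termWidth_top_ne_top hd hpos hω hanti hp
  have hC := nonneg_of_tendsto_div_powLog (fun k => (hL k).le) hlim
  have hasymp : ∀ {l : ℕ → ℝ} {D : ℝ}, (∀ k, 0 < l k) → 0 < D →
      Tendsto (fun n : ℕ => l n / powLog (-s) β n) atTop (𝓝 D) →
      Tendsto (fun n : ℕ => invPowSum l p (n + 1) ^ (-(1 / p)) / powLog (-(s + 1 / p)) β n) atTop
        (𝓝 ((s * p + 1) ^ (1 / p) * D)) := fun hl hD hlD => by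
    have := tendsto_comp_scaledIndex_div (t := 1) le_rfl
      (tendsto_invPowSum_rpow_div hl hs hp hD hlD)
    rw [Real.one_rpow, mul_one] at this
    simpa [scaledIndex] using this
  refine tendsto_div_of_bounds (fun n => ENNReal.toReal_nonneg) (by positivity) hC ?_ ?_
  · intro D hCD R hR
    obtain ⟨l, hl, hLl, hlD⟩ := exists_majorant hL hCD hlim
    filter_upwards [(hasymp hl (hC.trans_lt hCD) hlD).eventually_lt_const hR,
      eventually_one_lt_natCast] with n hn h1
    rw [div_lt_iff₀ (powLog_pos h1 _ _)] at hn
    have hR0 := (Real.rpow_nonneg (invPowSum_nonneg hl p (n + 1)) _).trans hn.le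
    exact ENNReal.toReal_le_of_le_ofReal hR0 (termWidth_top_le_of_apply_le hd hpos hω hanti hLl hp
      hR0 fun b hb hb0 hball => apply_le_of_sum_rpow_le hl hb hb0 hp hball hn.le)
  · intro hC
    refine ⟨_, fun n => ?_, hasymp hL hC hlim⟩
    have hW := invPowSum_pos hL p n.succ_pos
    have h := ofReal_apply_le_termWidth hpos e
      (b := fun _ => invPowSum (fun m => 1 / ω (e m)) p (n + 1) ^ (-(1 / p))) antitone_const
      (fun _ => by positivity) hp (invPowSum_rpow_mul_self hL hp n.succ_pos).le
    rwa [ENNReal.ofReal_le_iff_le_toReal (hfin n)] at h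

lemma termWidth_top_top (hd : 1 ≤ d) (hpos : ∀ k, 0 < ω k) (hω : Tendsto ω cofinite atTop)
    (hanti : Antitone fun m => 1 / ω (e m)) (n : ℕ) :
    termWidth ω ∞ ∞ n = ENNReal.ofReal (1 / ω (e n)) :=
  le_antisymm (termWidth_top_top_le hd hpos hω hanti n) (ofReal_le_termWidth_top_top hpos hanti n)

end Limits

/-! ### Limits of the widths for `q < p` -/

lemma tendsto_rpow_mul_invPowSum_div {U l : ℕ → ℝ} (hU : ∀ n, 0 ≤ U n) (hl : ∀ k, 0 < l k)
    {s β p r t v D : ℝ} (hs : 0 < s) (hp : 0 < p) (ht : 1 ≤ t) (hv : 0 < v) (hD : 0 < D)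
    (hUv : Tendsto (fun n : ℕ => U n / powLog (-s) β n) atTop (𝓝 v))
    (hlD : Tendsto (fun n : ℕ => l n / powLog (-s) β n) atTop (𝓝 D)) :
    Tendsto (fun n : ℕ => U n ^ (p + r) * invPowSum l p (scaledIndex t n) /
      powLog (1 - s * r) (β * r) n) atTop
      (𝓝 (v ^ (p + r) * (D ^ (-p) / (s * p + 1) * t ^ (s * p + 1)))) := by
  refine ((tendsto_rpow_div_powLog hU hv hUv (p + r)).mul
    (tendsto_comp_scaledIndex_div ht (tendsto_invPowSum_div hl hs hp hD hlD))).congr' ?_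
  filter_upwards [eventually_one_lt_natCast] with n hn
  rw [div_mul_div_comm, powLog_mul hn]
  congr 2 <;> ring

lemma tendsto_tsum_scaledIndex_div {l : ℕ → ℝ} (hl : ∀ k, 0 < l k) {s β r t D : ℝ}
    (hsr : 1 < s * r) (ht : 1 ≤ t) (hD : 0 < D)
    (hlD : Tendsto (fun n : ℕ => l n / powLog (-s) β n) atTop (𝓝 D)) :
    (Summable fun k => l k ^ r) ∧
    Tendsto (fun n : ℕ => (∑' k, l (k + scaledIndex t n) ^ r) / powLog (1 - s * r) (β * r) n) atTop
      (𝓝 (D ^ r / (s * r - 1) * t ^ (1 - s * r))) := by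
  obtain ⟨h1, h2⟩ := tendsto_tsum_div_powLog (by linarith : -s * r < -1)
    (tendsto_rpow_div_powLog (fun k => (hl k).le) hD hlD r)
  refine ⟨h1, ?_⟩
  have h3 := tendsto_comp_scaledIndex_div ht h2
  rwa [show -s * r + 1 = 1 - s * r by ring, show -(1 - s * r) = s * r - 1 by ring] at h3

section Exponents

variable {s p q r : ℝ}

lemma mul_div_eq_add_of_one_div (hq : 0 < q) (hr : 0 < r) (hp : 0 < p)
    (h : 1 / r = 1 / q - 1 / p) : p * (r / q) = p + r := by
  field_simp at h ⊢
  linarith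

/-- The two main terms of the bounds for `q < p` add up to the `r`-th power of the constant. -/
lemma add_eq_constGT_rpow (hs : 0 < s) (hr : 0 < r) (hp : 0 < p)
    (h : 1 / r = 1 / q - 1 / p) (hsr : 1 < s * r) :
    ((s + 1 / p) / s) ^ (1 - s * r) / (s * p + 1) + ((s + 1 / p) / s) ^ (1 - s * r) / (s * r - 1) =
      constGT s p q ^ r := by
  have hsr' : s * r - 1 ≠ 0 := by linarith
  have hb : 0 < s + 1 / p := by positivity
  have h1 : 0 < s - 1 / r := by
    rw [sub_pos, div_lt_iff₀ hr]; exact hsr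
  have e1 : 1 / q = 1 / r + 1 / p := by linarith
  have e2 : s + 1 / p - 1 / q = s - 1 / r := by linarith
  unfold constGT
  rw [← h, e2, e1, Real.mul_rpow (by positivity) (by positivity), ← Real.rpow_mul (by positivity),
    ← Real.rpow_mul (by positivity), one_div_mul_cancel hr.ne', Real.rpow_one,
    Real.rpow_sub (by positivity), Real.rpow_one, ← inv_div (s + 1 / p) s,
    Real.inv_rpow (by positivity)]
  have : ((s + 1 / p) / s) ^ (s * r) ≠ 0 := by positivity
  field_simp
  ring

end Exponents

section Limits

variable {d : ℕ} {ω : (Fin d → ℤ) → ℝ} {e : ℕ ≃ (Fin d → ℤ)}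

lemma termWidth_le_of_lt (hd : 1 ≤ d) (hpos : ∀ k, 0 < ω k) (hω : Tendsto ω cofinite atTop)
    (hanti : Antitone fun m => 1 / ω (e m)) {l : ℕ → ℝ} (hl : ∀ m, 1 / ω (e m) ≤ l m)
    {p q r A : ℝ} (hq : 0 < q) (hr : 0 < r) (hpqr : 1 / r = 1 / q - 1 / p) (hp : 0 < p)
    (hA : 0 ≤ A) {n : ℕ} (N : ℕ)
    (h : ∀ m, n < m → ((m - n : ℕ) : ℝ) ≤ A ^ p * invPowSum l p m)
    (hsum : Summable fun k => l k ^ r) :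
    termWidth ω (ENNReal.ofReal p) (ENNReal.ofReal q) n ≤
      ENNReal.ofReal ((A ^ (p + r) * invPowSum l p N + ∑' k, l (k + N) ^ r) ^ (1 / r)) := by
  have hl0 : ∀ k, 0 < l k := fun k => (one_div_pos.2 (hpos _)).trans_le (hl k)
  have hnn : 0 ≤ A ^ (p + r) * invPowSum l p N + ∑' k, l (k + N) ^ r :=
    add_nonneg (mul_nonneg (Real.rpow_nonneg hA _) (invPowSum_nonneg hl0 p N))
      (tsum_nonneg fun k => Real.rpow_nonneg (hl0 _).le _)
  refine termWidth_le_of_sum_Ico_le hd hpos hω hanti hl hp hq (by positivity)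
    fun b hb hb0 hball M => (sum_Ico_rpow_le_of_lt hl0 hb hb0 hq hr hpqr hp
      (Real.rpow_nonneg hA p) N hball h hsum M).trans_eq ?_
  rw [← Real.rpow_mul hA, mul_div_eq_add_of_one_div hq hr hp hpqr, ← Real.rpow_mul hnn]
  congr 1
  ring

lemma termWidth_ne_top_of_lt (hd : 1 ≤ d) (hpos : ∀ k, 0 < ω k) (hω : Tendsto ω cofinite atTop)
    (hanti : Antitone fun m => 1 / ω (e m)) {p q r : ℝ} (hq : 0 < q) (hr : 0 < r)
    (hpqr : 1 / r = 1 / q - 1 / p) (hp : 0 < p) (hsum : Summable fun k => (1 / ω (e k)) ^ r)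
    (n : ℕ) :
    termWidth ω (ENNReal.ofReal p) (ENNReal.ofReal q) n ≠ ∞ := by
  have hL : ∀ m, 0 < 1 / ω (e m) := fun m => one_div_pos.2 (hpos _)
  refine ne_top_of_le_ne_top ENNReal.ofReal_ne_top (termWidth_le_of_lt hd hpos hω hanti
    (fun m => le_rfl) hq hr hpqr hp (hL 0).le 0 (fun m _ => ?_) hsum)
  refine le_trans ?_ (natCast_le_mul_invPowSum hL hanti hp m)
  exact_mod_cast Nat.sub_le m n

/-- The lower bound for `q < p`: the extremal sequence is proportional to `l_k^{r/q}` for `k ≥ N`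
and constant for `k ≤ N`, where `l_k = 1 / ω (e k)`. -/
lemma le_termWidth_of_lt (hpos : ∀ k, 0 < ω k) (hanti : Antitone fun m => 1 / ω (e m)) {p q r : ℝ}
    (hq : 0 < q) (hr : 0 < r) (hpqr : 1 / r = 1 / q - 1 / p) (hp : 0 < p)
    (hsum : Summable fun k => (1 / ω (e k)) ^ r) {n : ℕ}
    (hfin : termWidth ω (ENNReal.ofReal p) (ENNReal.ofReal q) n ≠ ∞) {N : ℕ} (hnN : n ≤ N) :
    (((N - n : ℕ) : ℝ) * (1 / ω (e N)) ^ r + ∑' k, (1 / ω (e (k + N))) ^ r) ^ (1 / q) *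
      ((1 / ω (e N)) ^ (p + r) * invPowSum (fun m => 1 / ω (e m)) p N +
        ∑' k, (1 / ω (e (k + N))) ^ r) ^ (-(1 / p)) ≤
      (termWidth ω (ENNReal.ofReal p) (ENNReal.ofReal q) n).toReal := by
  set L : ℕ → ℝ := fun m => 1 / ω (e m) with hLdef
  have hL : ∀ m, 0 < L m := fun m => one_div_pos.2 (hpos _)
  set σ := (termWidth ω (ENNReal.ofReal p) (ENNReal.ofReal q) n).toReal with hσ
  have hsumN : Summable fun k => L (k + N) ^ r := (summable_nat_add_iff N).2 hsum
  have htail : 0 < ∑' k, L (k + N) ^ r :=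
    hsumN.tsum_pos (fun k => Real.rpow_nonneg (hL _).le _) 0 (Real.rpow_pos_of_pos (hL _) _)
  set G := L N ^ (p + r) * invPowSum L p N + ∑' k, L (k + N) ^ r with hG
  have hGpos : 0 < G := add_pos_of_nonneg_of_pos
    (mul_nonneg (Real.rpow_nonneg (hL _).le _) (invPowSum_nonneg hL p N)) htail
  set c := G ^ (-(1 / p)) with hc
  have hcpos : 0 < c := Real.rpow_pos_of_pos hGpos _
  have hcp : c ^ p = G⁻¹ := by
    rw [hc, ← Real.rpow_mul hGpos.le, show -(1 / p) * p = -1 by field_simp, Real.rpow_neg_one]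
  set b : ℕ → ℝ := fun m => c * L (max m N) ^ (r / q) with hb
  have hbpos : ∀ m, 0 ≤ b m := fun m => mul_nonneg hcpos.le (Real.rpow_nonneg (hL _).le _)
  have hbanti : Antitone b := fun i j hij => mul_le_mul_of_nonneg_left
    (Real.rpow_le_rpow (hL _).le (hanti (max_le_max_right N hij)) (by positivity)) hcpos.le
  have hpr := mul_div_eq_add_of_one_div hq hr hp hpqr
  have hball : ∀ j, ∑ m ∈ Finset.range (N + j), (b m / L m) ^ p ≤ 1 := by
    intro j
    have h1 : ∀ m, (b m / L m) ^ p = G⁻¹ * (L (max m N) ^ (p + r) * L m ^ (-p)) := by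
      intro m
      rw [Real.div_rpow (hbpos m) (hL m).le, hb,
        Real.mul_rpow hcpos.le (Real.rpow_nonneg (hL _).le _), hcp, ← Real.rpow_mul (hL _).le,
        show r / q * p = p + r by rw [← hpr, mul_comm], Real.rpow_neg (hL m).le]
      ring
    simp only [h1]
    rw [← Finset.mul_sum, inv_mul_le_iff₀ hGpos, mul_one, Finset.sum_range_add]
    refine add_le_add (le_of_eq ?_) ?_
    · rw [invPowSum, Finset.mul_sum]
      refine Finset.sum_congr rfl fun m hm => ?_
      rw [max_eq_right (Finset.mem_range.1 hm).le]
    · refine (le_of_eq (Finset.sum_congr rfl fun m _ => ?_)).trans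
        (hsumN.sum_le_tsum (Finset.range j) fun k _ => Real.rpow_nonneg (hL _).le _)
      rw [max_eq_left (Nat.le_add_right N m), ← Real.rpow_add (hL _), add_comm N m]
      congr 1; ring
  have hlow : ∀ j, c ^ q * (((N - n : ℕ) : ℝ) * L N ^ r + ∑ k ∈ Finset.range j, L (k + N) ^ r) ≤
      σ ^ q := by
    intro j
    have h := ofReal_sum_Ico_le_termWidth hpos e hbanti hbpos hp hq (hball j) n
    rw [ENNReal.ofReal_le_iff_le_toReal hfin, one_div, Real.rpow_inv_le_iff_of_pos
      (Finset.sum_nonneg fun m _ => Real.rpow_nonneg (hbpos m) _) ENNReal.toReal_nonneg hq] at h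
    refine le_trans (le_of_eq ?_) h
    have h1 : ∀ m, b m ^ q = c ^ q * L (max m N) ^ r := fun m => by
      rw [hb, Real.mul_rpow hcpos.le (Real.rpow_nonneg (hL _).le _), ← Real.rpow_mul (hL _).le,
        div_mul_cancel₀ _ hq.ne']
    simp only [h1]
    rw [← Finset.mul_sum, ← Finset.sum_Ico_consecutive _ hnN (Nat.le_add_right N j)]
    congr 2
    · rw [Finset.sum_congr rfl fun m hm =>
        show L (max m N) ^ r = L N ^ r by rw [max_eq_right (Finset.mem_Ico.1 hm).2.le]]
      simp
    · rw [Finset.sum_Ico_eq_sum_range, Nat.add_sub_cancel_left]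
      refine Finset.sum_congr rfl fun m _ => ?_
      rw [max_eq_left (Nat.le_add_right N m), add_comm]
  have hlim := le_of_tendsto' ((hsumN.hasSum.tendsto_sum_nat.const_add _).const_mul (c ^ q)) hlow
  have hE : 0 ≤ ((N - n : ℕ) : ℝ) * L N ^ r + ∑' k, L (k + N) ^ r :=
    add_nonneg (mul_nonneg (Nat.cast_nonneg _) (Real.rpow_nonneg (hL _).le _)) htail.le
  have hfinal := Real.rpow_le_rpow (mul_nonneg (Real.rpow_nonneg hcpos.le _) hE) hlim
    (one_div_nonneg.2 hq.le)
  rw [Real.mul_rpow (Real.rpow_nonneg hcpos.le _) hE, ← Real.rpow_mul hcpos.le,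
    ← Real.rpow_mul ENNReal.toReal_nonneg, mul_one_div_cancel hq.ne', Real.rpow_one,
    Real.rpow_one, mul_comm] at hfinal
  exact hfinal

theorem tendsto_termWidth_of_lt (hd : 1 ≤ d) (hpos : ∀ k, 0 < ω k) (hω : Tendsto ω cofinite atTop)
    (hanti : Antitone fun m => 1 / ω (e m)) {s β C : ℝ} (hs : 0 < s) (hβ : 0 ≤ β)
    (hlim : Tendsto (fun n : ℕ => 1 / ω (e n) / powLog (-s) β n) atTop (𝓝 C)) {p q r : ℝ}
    (hq : 0 < q) (hr : 0 < r) (hpqr : 1 / r = 1 / q - 1 / p) (hp : 0 < p) (hsr : 1 < s * r) :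
    (∀ n, termWidth ω (ENNReal.ofReal p) (ENNReal.ofReal q) n ≠ ∞) ∧
    Tendsto (fun n : ℕ => (termWidth ω (ENNReal.ofReal p) (ENNReal.ofReal q) n).toReal /
      powLog (1 / r - s) β n) atTop (𝓝 (constGT s p q * C)) := by
  have hL : ∀ m, 0 < 1 / ω (e m) := fun m => one_div_pos.2 (hpos _)
  have hC := nonneg_of_tendsto_div_powLog (fun k => (hL k).le) hlim
  set t := (s + 1 / p) / s with ht_def
  have ht : 1 ≤ t := by
    rw [ht_def, one_le_div hs]
    have : 0 < 1 / p := by positivity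
    linarith
  have ht0 : 0 < t := by linarith
  have hsp : 0 < s * p + 1 := by positivity
  have hsr' : 0 < s * r - 1 := by linarith
  have hid := add_eq_constGT_rpow hs hr hp hpqr hsr
  rw [← ht_def] at hid
  have hKr : 0 < constGT s p q ^ r := by rw [← hid]; positivity
  have hK : 0 < constGT s p q := by
    have h1 : 1 / q = 1 / r + 1 / p := by linarith
    have h2 : 0 < s - 1 / r := by rw [sub_pos, div_lt_iff₀ hr]; exact hsr
    have h3 : s + 1 / p - 1 / q = s - 1 / r := by linarith
    unfold constGT
    rw [h3]; positivity
  have hpr := mul_div_eq_add_of_one_div hq hr hp hpqr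
  -- The radicand of the upper bound with `A = (v n ^ (-s) (log n) ^ β) ^ p`, at the optimal `v`.
  have hvalue : ∀ D, 0 < D → (t ^ (-s) * D) ^ (p + r) * (D ^ (-p) / (s * p + 1) * t ^ (s * p + 1)) +
      D ^ r / (s * r - 1) * t ^ (1 - s * r) = (constGT s p q * D) ^ r := by
    intro D hD
    have e1 : (t ^ (-s) * D) ^ (p + r) * (D ^ (-p) / (s * p + 1) * t ^ (s * p + 1)) =
        (t ^ (-s * (p + r)) * t ^ (s * p + 1)) * (D ^ (p + r) * D ^ (-p)) / (s * p + 1) := by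
      rw [Real.mul_rpow (by positivity) hD.le, ← Real.rpow_mul ht0.le]
      ring
    rw [e1, ← Real.rpow_add ht0, ← Real.rpow_add hD, Real.mul_rpow hK.le hD.le, ← hid,
      show -s * (p + r) + (s * p + 1) = 1 - s * r by ring, show p + r + -p = r by ring]
    ring
  obtain ⟨l₁, hl₁, hLl₁, hlD₁⟩ := exists_majorant hL (lt_add_one C) hlim
  have hsum : Summable fun k => (1 / ω (e k)) ^ r :=
    Summable.of_nonneg_of_le (fun k => Real.rpow_nonneg (hL k).le _)
      (fun k => Real.rpow_le_rpow (hL k).le (hLl₁ k) hr.le)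
      (tendsto_tsum_scaledIndex_div hl₁ hsr ht (by linarith) hlD₁).1
  have hfin := termWidth_ne_top_of_lt hd hpos hω hanti hq hr hpqr hp hsum
  refine ⟨hfin, tendsto_div_of_bounds (fun n => ENNReal.toReal_nonneg) hK hC ?_ ?_⟩
  · intro D hCD R hR
    have hD := hC.trans_lt hCD
    obtain ⟨l, hl, hLl, hlD⟩ := exists_majorant hL hCD hlim
    obtain ⟨hlsum, htail⟩ := tendsto_tsum_scaledIndex_div hl hsr ht hD hlD
    set F : ℝ → ℝ := fun v => (v ^ (p + r) * (D ^ (-p) / (s * p + 1) * t ^ (s * p + 1)) +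
      D ^ r / (s * r - 1) * t ^ (1 - s * r)) ^ (1 / r) with hF
    have hv₀ : 0 < t ^ (-s) * D := by positivity
    have hF₀ : F (t ^ (-s) * D) = constGT s p q * D := by
      simp only [hF]
      rw [hvalue D hD, ← Real.rpow_mul (by positivity), mul_one_div_cancel hr.ne', Real.rpow_one]
    have hFcont : ContinuousAt F (t ^ (-s) * D) := by
      refine ContinuousAt.rpow_const ?_ (Or.inr (by positivity))
      exact ((Real.continuousAt_rpow_const _ _ (Or.inl hv₀.ne')).mul_const _).add_const _
    obtain ⟨v, hFv, hv⟩ := (((hFcont.tendsto.eventually_lt_const (u := R)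
      (hF₀.trans_lt hR)).filter_mono
      (nhdsWithin_le_nhds (s := Set.Ioi (t ^ (-s) * D)))).and self_mem_nhdsWithin).exists
    have hv' : t ^ (-s) * D < v := hv
    have hvpos : 0 < v := hv₀.trans hv'
    have hUv : Tendsto (fun n : ℕ => v * powLog (-s) β n / powLog (-s) β n) atTop (𝓝 v) := by
      refine tendsto_const_nhds.congr' ?_
      filter_upwards [eventually_one_lt_natCast] with n hn
      rw [mul_div_cancel_right₀ _ (powLog_pos hn _ _).ne']
    have hU0 : ∀ n : ℕ, 0 ≤ v * powLog (-s) β n := fun n =>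
      mul_nonneg hvpos.le (powLog_nonneg_nat _ _ n)
    have hrad := (tendsto_rpow_mul_invPowSum_div (r := r) hU0 hl hs hp ht hvpos hD hUv
      hlD).add htail
    have hrad' := (hrad.rpow_const (p := 1 / r) (Or.inr (by positivity))).eventually_lt_const hFv
    have hab : 1 / p < s + 1 / p := by linarith
    -- The extremal problem for `p = q` supplies the constant in the majorization.
    have hκ : maxRatio (1 / p) (s + 1 / p) * ((s * p + 1) ^ (1 / p) * D) = t ^ (-s) * D := by
      have hx : t = (s * p + 1) / (s * p) := by rw [ht_def]; field_simp
      rw [maxRatio_eq (by positivity) hab, add_sub_cancel_right, ← ht_def, neg_add,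
        Real.rpow_add ht0, Real.rpow_neg ht0.le (1 / p)]
      have h1 : t - 1 = t / (s * p + 1) := by rw [hx]; field_simp; ring
      rw [h1, Real.div_rpow ht0.le hsp.le]
      field_simp
    filter_upwards [hrad', eventually_one_lt_natCast,
      eventually_forall_mul_le (by positivity) hab hβ
      (by positivity) (tendsto_invPowSum_rpow_div hl hs hp hD hlD) (hκ.trans_lt hv')]
      with n hn h1 hmaj
    have hP := powLog_pos h1 (1 - s * r) (β * r)
    have hmaj' : ∀ m, n < m → ((m - n : ℕ) : ℝ) ≤ (v * powLog (-s) β n) ^ p * invPowSum l p m := by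
      intro m hm
      have hW := invPowSum_pos hl p (Nat.zero_lt_of_lt hm)
      have h2 := hmaj m hm
      rw [show 1 / p - (s + 1 / p) = -s by ring] at h2
      have h3 := Real.rpow_le_rpow (by positivity) h2 hp.le
      rw [Real.mul_rpow (by positivity) (by positivity), ← Real.rpow_mul (Nat.cast_nonneg _),
        ← Real.rpow_mul hW.le, one_div_mul_cancel hp.ne', Real.rpow_one,
        show -(1 / p) * p = -1 by field_simp, Real.rpow_neg_one, ← div_eq_mul_inv,
        div_le_iff₀ hW] at h3
      exact h3
    have hup := termWidth_le_of_lt hd hpos hω hanti hLl hq hr hpqr hp (hU0 n) (scaledIndex t n)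
      hmaj' hlsum
    have hrad0 : 0 ≤ (v * powLog (-s) β n) ^ (p + r) * invPowSum l p (scaledIndex t n) +
        ∑' k, l (k + scaledIndex t n) ^ r :=
      add_nonneg (mul_nonneg (Real.rpow_nonneg (hU0 n) _) (invPowSum_nonneg hl p _))
        (tsum_nonneg fun k => Real.rpow_nonneg (hl _).le _)
    refine (ENNReal.toReal_le_of_le_ofReal (by positivity) hup).trans ?_
    rw [← add_div, Real.div_rpow hrad0 hP.le, powLog_rpow h1,
      show (1 - s * r) * (1 / r) = 1 / r - s by field_simp,
      show β * r * (1 / r) = β by field_simp, div_lt_iff₀ (powLog_pos h1 _ _)] at hn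
    exact hn.le
  · intro hC
    refine ⟨_, fun n => le_termWidth_of_lt hpos hanti hq hr hpqr hp hsum (hfin n)
      (lt_scaledIndex ht n).le, ?_⟩
    obtain ⟨-, htail⟩ := tendsto_tsum_scaledIndex_div hL hsr ht hC hlim
    have hLN := tendsto_comp_scaledIndex_div ht hlim
    rw [mul_comm] at hLN
    have hG := (tendsto_rpow_mul_invPowSum_div (r := r) (fun n => (hL _).le) hL hs hp ht
      (by positivity) hC hLN hlim).add htail
    have hE : Tendsto (fun n : ℕ => ((scaledIndex t n - n : ℕ) : ℝ) *
        (1 / ω (e (scaledIndex t n))) ^ r / powLog (1 - s * r) (β * r) n) atTop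
        (𝓝 ((t - 1) * (t ^ (-s) * C) ^ r)) := by
      refine ((tendsto_scaledIndex_sub_div ht).mul (tendsto_rpow_div_powLog (fun n => (hL _).le)
        (by positivity) hLN r)).congr' ?_
      filter_upwards [eventually_one_lt_natCast] with n hn
      have hn0 : (n : ℝ) ≠ 0 := by linarith
      rw [div_mul_div_comm, powLog, powLog, show 1 - s * r = -s * r + 1 by ring,
        Real.rpow_add_one hn0]
      congr 1
      ring
    have hEval : (t - 1) * (t ^ (-s) * C) ^ r + C ^ r / (s * r - 1) * t ^ (1 - s * r) =
        (constGT s p q * C) ^ r := by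
      have hx : t = (s * p + 1) / (s * p) := by rw [ht_def]; field_simp
      have h1 : t - 1 = t / (s * p + 1) := by rw [hx]; field_simp; ring
      rw [Real.mul_rpow hK.le hC.le, ← hid, Real.mul_rpow (by positivity) hC.le,
        ← Real.rpow_mul ht0.le, h1, show 1 - s * r = 1 + -s * r by ring, Real.rpow_add ht0,
        Real.rpow_one]
      ring
    have hE' := hE.add htail
    rw [hEval] at hE'
    rw [hvalue C hC] at hG
    have hKC : 0 < (constGT s p q * C) ^ r := by positivity
    have hmain := (hE'.rpow_const (p := 1 / q) (Or.inl hKC.ne')).mul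
      (hG.rpow_const (p := -(1 / p)) (Or.inl hKC.ne'))
    rw [← Real.rpow_add hKC, ← sub_eq_add_neg, ← hpqr, ← Real.rpow_mul (by positivity),
      mul_one_div_cancel hr.ne', Real.rpow_one] at hmain
    refine hmain.congr' ?_
    filter_upwards [eventually_one_lt_natCast] with n hn
    have hP := powLog_pos hn (1 - s * r) (β * r)
    have htail0 : 0 ≤ ∑' k, (1 / ω (e (k + scaledIndex t n))) ^ r :=
      tsum_nonneg fun k => Real.rpow_nonneg (hL _).le _
    have hPr : powLog (1 / r - s) β n =
        powLog (1 - s * r) (β * r) n ^ (1 / q) * powLog (1 - s * r) (β * r) n ^ (-(1 / p)) := by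
      rw [← Real.rpow_add hP, ← sub_eq_add_neg, ← hpqr, powLog_rpow hn]
      congr 1 <;> field_simp
    rw [← add_div, ← add_div, Real.div_rpow (add_nonneg (mul_nonneg (Nat.cast_nonneg _)
      (Real.rpow_nonneg (hL _).le _)) htail0) hP.le, Real.div_rpow (add_nonneg (mul_nonneg
      (Real.rpow_nonneg (hL _).le _) (invPowSum_nonneg hL p _)) htail0) hP.le, div_mul_div_comm,
      hPr]

end Limits

/-! ### The constants for `p ≤ q` -/

lemma constLE_eq {s p q : ℝ} (hs : 0 < s) (hp : 0 < p) (hpq : p ≤ q) :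
    constLE s p q = maxRatio (1 / q) (s + 1 / p) * (s * p + 1) ^ (1 / p) := by
  have hq := hp.trans_le hpq
  have hba : 0 < s + 1 / p - 1 / q := by linarith [one_div_le_one_div_of_le hp hpq]
  have hb : 0 < s + 1 / p := by positivity
  have e1 : s * p + 1 = p * (s + 1 / p) := by field_simp
  unfold constLE maxRatio
  rw [e1, Real.mul_rpow hp.le hb.le, Real.rpow_add hb s, Real.div_rpow zero_le_one hq.le,
    Real.one_rpow]
  field_simp

lemma tendsto_constLE_atTop {s p : ℝ} (hs : 0 < s) (hp : 0 < p) :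
    Tendsto (fun q : ℝ => constLE s p q) atTop (𝓝 ((s * p + 1) ^ (1 / p))) := by
  have hb : 0 < s + 1 / p := by positivity
  have h0 : Tendsto (fun q : ℝ => 1 / q) atTop (𝓝 0) := by
    simpa only [one_div] using tendsto_inv_atTop_zero
  have h1 : Tendsto (fun q : ℝ => s + 1 / p - 1 / q) atTop (𝓝 (s + 1 / p)) := by
    simpa using h0.const_sub (s + 1 / p)
  have h2 := (((h1.rpow h1 (Or.inl hb.ne')).div_const ((s + 1 / p) ^ s)).mul
    ((tendsto_const_nhds (x := p ^ (1 / p))).div tendsto_rpow_div one_ne_zero))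
  have e1 : s * p + 1 = p * (s + 1 / p) := by field_simp
  have e2 : (s * p + 1) ^ (1 / p) =
      (s + 1 / p) ^ (s + 1 / p) / (s + 1 / p) ^ s * (p ^ (1 / p) / 1) := by
    rw [e1, Real.mul_rpow hp.le hb.le, Real.rpow_add hb s]
    field_simp
  rw [e2]
  exact h2

lemma tendsto_constLE_atTop_prod {s : ℝ} (hs : 0 < s) :
    Tendsto (fun r : ℝ × ℝ => constLE s r.1 r.2) (atTop ×ˢ atTop) (𝓝 1) := by
  have h0 : Tendsto (fun q : ℝ => 1 / q) atTop (𝓝 0) := by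
    simpa only [one_div] using tendsto_inv_atTop_zero
  have h1 := (h0.comp (tendsto_fst (f := atTop) (g := (atTop : Filter ℝ)))).const_add s
  have h2 := h1.sub (h0.comp (tendsto_snd (f := (atTop : Filter ℝ)) (g := atTop)))
  rw [add_zero] at h1
  rw [add_zero, sub_zero] at h2
  have hs' : s ^ s ≠ 0 := (Real.rpow_pos_of_pos hs s).ne'
  have h3 := ((h2.rpow h2 (Or.inl hs.ne')).div (h1.rpow_const (p := s) (Or.inl hs.ne')) hs').mul
    ((tendsto_rpow_div.comp (tendsto_fst (f := atTop) (g := (atTop : Filter ℝ)))).div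
      (tendsto_rpow_div.comp (tendsto_snd (f := (atTop : Filter ℝ)) (g := atTop))) one_ne_zero)
  rwa [div_self hs', div_one, mul_one] at h3

/-! ### The limits of the widths -/

theorem theorem3p4 (d : ℕ) (hd : 1 ≤ d) (ω : (Fin d → ℤ) → ℝ) (hpos : ∀ k, 0 < ω k)
    (hω : Tendsto ω cofinite atTop) (s β C : ℝ) (hs : 0 < s) (hβ : 0 ≤ β)
    (hC : Tendsto
      (fun n : ℕ => decreasingRearrangement (fun k => 1 / ω k) n /
        ((n : ℝ) ^ (-s) * Real.log n ^ β)) atTop (𝓝 C)) :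
    -- the case `0 < p ≤ q < ∞`
    (∀ p q : ℝ, 0 < p → p ≤ q →
      (∀ n, termWidth ω (ENNReal.ofReal p) (ENNReal.ofReal q) n ≠ ∞) ∧
      Tendsto (fun n : ℕ => (termWidth ω (ENNReal.ofReal p) (ENNReal.ofReal q) n).toReal /
        ((n : ℝ) ^ (-s - 1 / p + 1 / q) * Real.log n ^ β)) atTop (𝓝 (constLE s p q * C))) ∧
    -- the case `0 < p < q = ∞`; the constant is the limit of the previous one as `q → ∞`
    (∀ p : ℝ, 0 < p →
      Tendsto (fun q : ℝ => constLE s p q) atTop (𝓝 ((s * p + 1) ^ (1 / p))) ∧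
      (∀ n, termWidth ω (ENNReal.ofReal p) ∞ n ≠ ∞) ∧
      Tendsto (fun n : ℕ => (termWidth ω (ENNReal.ofReal p) ∞ n).toReal /
        ((n : ℝ) ^ (-s - 1 / p) * Real.log n ^ β)) atTop (𝓝 ((s * p + 1) ^ (1 / p) * C))) ∧
    -- the case `p = q = ∞`; the constant `1` is the limit as `p, q → ∞`
    (Tendsto (fun r : ℝ × ℝ => constLE s r.1 r.2) (atTop ×ˢ atTop) (𝓝 1) ∧
      (∀ n, termWidth ω ∞ ∞ n ≠ ∞) ∧
      Tendsto (fun n : ℕ => (termWidth ω ∞ ∞ n).toReal /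
        ((n : ℝ) ^ (-s) * Real.log n ^ β)) atTop (𝓝 (1 * C))) ∧
    -- the case `0 < q < p < ∞`
    (∀ p q : ℝ, 0 < q → q < p → 1 / q - 1 / p < s →
      (∀ n, termWidth ω (ENNReal.ofReal p) (ENNReal.ofReal q) n ≠ ∞) ∧
      Tendsto (fun n : ℕ => (termWidth ω (ENNReal.ofReal p) (ENNReal.ofReal q) n).toReal /
        ((n : ℝ) ^ (-s - 1 / p + 1 / q) * Real.log n ^ β)) atTop (𝓝 (constGT s p q * C))) := by
  obtain ⟨e, hanti, hrearr⟩ := exists_equiv_antitone hd hpos hω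
  have hlim : Tendsto (fun n : ℕ => 1 / ω (e n) / powLog (-s) β n) atTop (𝓝 C) :=
    tendsto_div_powLog_of_succ hrearr hC
  refine ⟨fun p q hp hpq => ⟨termWidth_ne_top_of_le hd hpos hω hanti hp hpq, ?_⟩,
    fun p hp => ⟨tendsto_constLE_atTop hs hp, termWidth_top_ne_top hd hpos hω hanti hp, ?_⟩,
    ⟨tendsto_constLE_atTop_prod hs, fun n => ?_, ?_⟩, fun p q hq hqp hsr => ?_⟩
  · have h := tendsto_termWidth_of_le hd hpos hω hanti hs hβ hlim hp hpq
    rwa [← constLE_eq hs hp hpq, show 1 / q - (s + 1 / p) = -s - 1 / p + 1 / q by ring] at h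
  · have h := tendsto_termWidth_top hd hpos hω hanti hs hlim hp
    rwa [show -(s + 1 / p) = -s - 1 / p by ring] at h
  · rw [termWidth_top_top hd hpos hω hanti]
    exact ENNReal.ofReal_ne_top
  · rw [one_mul]
    refine hlim.congr fun n => ?_
    rw [termWidth_top_top hd hpos hω hanti, ENNReal.toReal_ofReal (one_div_pos.2 (hpos _)).le]
    rfl
  · have hp := hq.trans hqp
    have hr : 0 < 1 / q - 1 / p := sub_pos.2 (one_div_lt_one_div_of_lt hq hqp)
    have h := tendsto_termWidth_of_lt (r := (1 / q - 1 / p)⁻¹) hd hpos hω hanti hs hβ hlim hq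
      (inv_pos.2 hr) (by rw [one_div, inv_inv]) hp (by rwa [← div_eq_mul_inv, one_lt_div hr])
    rwa [one_div (1 / q - 1 / p)⁻¹, inv_inv,
      show 1 / q - 1 / p - s = -s - 1 / p + 1 / q by ring] at h
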